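/- Let $d\ge 2$, $\lambda_S\in(0,\infty)$, $\lambda\in[0,\infty)$ and $p\in[0,1]$. Random measures and point processes on $\mathbb{R}^d$ are random elements of the space $\mathbf M$ of Borel measures on $\mathbb{R}^d$, equipped with the smallest $\sigma$-algebra making all evaluations $\mu\mapsto\mu(B)$, $B$ Borel, measurable; point configurations are identified with their counting measures. Let $X_S$ be a homogeneous Poisson point process on $\mathbb{R}^d$ with intensity $\lambda_S$. The Voronoi cell of a point $x$ of $X_S$ is the set of all $y$ with $\|y-x\|\le\|y-z\|$ for every point $z$ of $X_S$. For $k\ge 0$, the $k$-facets of the Poisson-Voronoi tessellation are the sets of the form $\bigcap\{C : C \text{ a cell},\ y\in C\}$, $y\in\mathbb{R}^d$, whose affine hull has dimension $k$. Let $S$ be the union of the edges ($1$-facets), let $V$ be the set of vertices ($0$-facets), and let $\Lambda(B)=\nu_1(S\cap B)$, where $\nu_1$ is the one-dimensional Hausdorff measure. Let $X$ and $Y$ be point processes, defined on the same probability space as $X_S$, such that, conditionally on $\Lambda$: (i) $X$ (the users) is a Poisson point process with intensity measure $\lambda\Lambda$, i.e. $X$ is a Cox process driven by $\lambda\Lambda$;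 (ii) $Y$ (the relays) is a Bernoulli point process on $V$ with parameter $p$, i.e. each vertex belongs to $Y$ with probability $p$, independently of the others; (iii) $X$ and $Y$ are independent. Let $Z=X+Y$ be the superposition of the users and the relays, let $Q$ be the law of $Z$ on $\mathbf M$, and let $S_x:\mathbf M\to\mathbf M$, $x\in\mathbb{R}^d$, be the shift $S_x\mu(B)=\mu(B-x)$. Then $Z$ is stationary ($Q(S_x^{-1}A)=Q(A)$ for all $x$ and all measurable $A\subseteq\mathbf M$) and mixing: $$\lim_{\|x\|\to\infty}Q\big(A\cap S_x^{-1}B\big)=Q(A)\,Q(B)\qquad\text{for all measurable } A,B\subseteq\mathbf M.$$ Moreover $Z$ is ergodic: every measurable $A\subseteq\mathbf M$ such that, for each $x\in\mathbb{R}^d$, $S_x^{-1}A=A$ up to a $Q$-null set, satisfies $Q(A)\in\{0,1\}$. -/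

import Mathlib

open MeasureTheory ProbabilityTheory Filter Topology
open scoped NNReal ENNReal

noncomputable section

namespace CoxVoronoi

/-! ### Random configurations

Random measures and point processes on `ℝ^d` are random elements of the space of Borel measures on
`ℝ^d`, which carries the evaluation sigma-algebra (the smallest one that makes `μ ↦ μ B` measurable
for all Borel sets `B`; it is Mathlib's instance on `Measure`). A point configuration is identified
with its counting measure. -/

/-- `d`-dimensional Euclidean space. -/
abbrev Space (d : ℕ) : Type := EuclideanSpace ℝ (Fin d)

/-- Counting measures of locally finite point configurations (with multiplicities). -/
def IsPointMeasure {d : ℕ} (ξ : Measure (Space d)) : Prop :=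
  IsLocallyFiniteMeasure ξ ∧ ∀ B : Set (Space d), MeasurableSet B → ∃ n : ℕ∞, ξ B = (n : ℝ≥0∞)

/-- The Poisson distribution with mean `m ∈ [0, ∞]`, as a measure on `[0, ∞]`; the Poisson
distribution with mean `∞` is the point mass at `∞`. -/
def poissonDist (m : ℝ≥0∞) : Measure ℝ≥0∞ :=
  if m = ∞ then Measure.dirac ∞
  else (poissonMeasure m.toNNReal).map (fun n : ℕ => (n : ℝ≥0∞))

/-- `L` is the law of a Poisson point process on `ℝ^d` with intensity (mean) measure `μ`. -/
structure IsPoissonLaw {d : ℕ} (L : Measure (Measure (Space d))) (μ : Measure (Space d)) :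
    Prop where
  isProbabilityMeasure : IsProbabilityMeasure L
  isPointMeasure : ∀ᵐ ξ ∂L, IsPointMeasure ξ
  map_eval : ∀ B : Set (Space d), MeasurableSet B → L.map (fun ξ => ξ B) = poissonDist (μ B)
  iIndepFun_eval : ∀ (n : ℕ) (B : Fin n → Set (Space d)), (∀ i, MeasurableSet (B i)) →
    Pairwise (fun i j => Disjoint (B i) (B j)) →
    iIndepFun (fun (i : Fin n) (ξ : Measure (Space d)) => ξ (B i)) L

/-- The law of the Bernoulli point process on a countable set `V` with parameter `p`: every point
of `V` is retained with probability `p`, independently of the others. -/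
def bernoulliLaw {d : ℕ} (V : Set (Space d)) (p : unitInterval) : Measure (Measure (Space d)) :=
  (setBernoulli (Set.univ : Set V) p).map
    (fun s : Set V => Measure.sum (s.indicator fun v : V => Measure.dirac (v : Space d)))

/-! ### Voronoi tessellation of a set of nuclei -/

/-- The points charged by a configuration. -/
def points {d : ℕ} (ξ : Measure (Space d)) : Set (Space d) := {x | ξ {x} ≠ 0}

/-- The Voronoi cell of the nucleus `x`: the points that have no nucleus closer than `x`. -/
def cell {d : ℕ} (φ : Set (Space d)) (x : Space d) : Set (Space d) :=
  {y | ∀ z ∈ φ, dist y x ≤ dist y z}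

/-- The facet of the Voronoi tessellation that has `y` in its relative interior: the intersection of
all the cells that contain `y`. -/
def facetAt {d : ℕ} (φ : Set (Space d)) (y : Space d) : Set (Space d) :=
  ⋂ x ∈ {x ∈ φ | y ∈ cell φ x}, cell φ x

/-- The `k`-facets of the Voronoi tessellation: the facets whose affine hull has dimension `k`. -/
def facets {d : ℕ} (φ : Set (Space d)) (k : ℕ) : Set (Set (Space d)) :=
  {F | (∃ y, F = facetAt φ y) ∧ Module.finrank ℝ (vectorSpan ℝ F) = k}

/-- The street system: the union of the edges (`1`-facets) of the Voronoi tessellation. -/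
def streets {d : ℕ} (φ : Set (Space d)) : Set (Space d) := ⋃₀ facets φ 1

/-- The crossroads: the set of vertices (`0`-facets) of the Voronoi tessellation. -/
def crossroads {d : ℕ} (φ : Set (Space d)) : Set (Space d) := ⋃₀ facets φ 0

/-- The edge length measure `B ↦ ν₁(S ∩ B)` of the Voronoi tessellation whose nuclei are the points
of `ξ`, where `ν₁` is the one-dimensional Hausdorff measure. -/
def edgeLength {d : ℕ} (ξ : Measure (Space d)) : Measure (Space d) :=
  (Measure.hausdorffMeasure 1).restrict (streets (points ξ))

/-! ### Users and relays -/

/-- `XS` is a homogeneous Poisson point process of intensity `lamS`. Write `Λ` for the edge length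
measure of its Voronoi tessellation. Given `Λ`,
* the process `X` of users is a Poisson point process with intensity measure `lam • Λ` (so it is a
  Cox process driven by `lam • Λ`),
* the process `Y` of relays is a Bernoulli point process with parameter `p` on the vertices of the
  tessellation,
* `X` and `Y` are independent: the conditional law of `(X, Y)` is the product of those of `X` and
  of `Y`. -/
structure IsUserRelayModel {d : ℕ} {Ω : Type*} [MeasurableSpace Ω] (P : Measure Ω)
    (lamS lam : ℝ≥0) (p : unitInterval) (XS X Y : Ω → Measure (Space d)) : Prop where
  aemeasurable_nuclei : AEMeasurable XS P
  nuclei : IsPoissonLaw (P.map XS) (lamS • (volume : Measure (Space d)))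
  users_relays : ∃ κX κY : Kernel (Measure (Space d)) (Measure (Space d)),
    IsMarkovKernel κX ∧ IsMarkovKernel κY ∧
    HasCondDistrib (fun ω => (X ω, Y ω)) (fun ω => edgeLength (XS ω)) (κX ×ₖ κY) P ∧
    (∀ᵐ ω ∂P, IsPoissonLaw (κX (edgeLength (XS ω))) (lam • edgeLength (XS ω))) ∧
    (∀ᵐ ω ∂P, κY (edgeLength (XS ω)) = bernoulliLaw (crossroads (points (XS ω))) p)

/-! ### Mixing under spatial shifts -/

/-- The spatial shifts: the translations of `ℝ^d` act on measures by push-forward. -/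
instance instVAddMeasure {d : ℕ} : VAdd (Space d) (Measure (Space d)) :=
  ⟨fun x ξ => ξ.map (fun y => x + y)⟩

/-- The law `Q` of a random measure on `ℝ^d` is mixing: it is stationary, and
`Q (A ∩ S_x B) → Q A * Q B` as `‖x‖ → ∞`, for all events `A` and `B`. -/
structure IsMixing {d : ℕ} (Q : Measure (Measure (Space d))) : Prop where
  stationary : VAddInvariantMeasure (Space d) (Measure (Space d)) Q
  tendsto : ∀ A B : Set (Measure (Space d)), MeasurableSet A → MeasurableSet B →
    Tendsto (fun x : Space d => Q (A ∩ (fun ξ : Measure (Space d) => x +ᵥ ξ) ⁻¹' B))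
      (Bornology.cobounded (Space d)) (𝓝 (Q A * Q B))

end CoxVoronoi

end

/-! Conditionally on the nuclei, the users and relays in a region and those in its complement are
independent, since Poisson and Bernoulli processes both have this property and it survives
independent superposition. The conditional law `k ξ` of `Z` given nuclei `ξ` also commutes with
translations, because the tessellation does. For events `A`, `B` seen in bounded windows and `x` far
away, `Q (A ∩ S_x⁻¹ B)` is therefore the integral of `k ξ A * k (x +ᵥ ξ) B` over the law of the
nuclei. That law is itself mixing (a stationary process with independent restrictions), so the
integral tends to `Q A * Q B`. This is `IsMixing.comp_kernel`, fed by `IsMixing.of_isSplice` and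
`IsMixing.tendsto_lintegral`; `IsMixing.of_localEvents` passes from window events to all events by
approximation. Ergodicity follows because an invariant event satisfies `Q A = Q A * Q A`.

Independence is encoded by `IsSplice`: gluing two independent copies along the boundary of `K`
reproduces the law. For Poisson processes it is read off the probabilities of cylinders, for
Bernoulli processes off the underlying product measure.

The remaining work is measurability. The hypotheses on the conditional laws hold for almost every
`ω`, and they are transferred to almost every configuration of nuclei by means of measurable
versions of the edge length measure and of the Bernoulli law on the vertices. These come from
countable enumerations: nuclei are barycenters of small balls, vertices are circumcenters given by
Cramer's rule, and edges are covered by pieces of lines parametrized by the same rule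
(`exists_measurable_edgeLength`, `exists_measurable_bernoulliLaw_crossroads`). -/

namespace CoxVoronoi

/-! ### Cylinder events determine laws of random measures -/

section Cylinders

variable {α : Type*} [MeasurableSpace α]

/-- The measures whose value on each `B i` belongs to `T i`. -/
def cylinderOf {ι : Type*} (B : ι → Set α) (T : ι → Set ℝ≥0∞) : Set (Measure α) :=
  {ξ | ∀ i, ξ (B i) ∈ T i}

theorem measurableSet_cylinderOf {ι : Type*} [Countable ι] {B : ι → Set α} {T : ι → Set ℝ≥0∞}
    (hB : ∀ i, MeasurableSet (B i)) (hT : ∀ i, MeasurableSet (T i)) :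
    MeasurableSet (cylinderOf B T) := by
  have : cylinderOf B T = ⋂ i, (fun ξ : Measure α => ξ (B i)) ⁻¹' T i := by
    ext ξ; simp [cylinderOf]
  rw [this]
  exact MeasurableSet.iInter fun i => Measure.measurable_coe (hB i) (hT i)

theorem ext_of_boxes {σ : Type*} [Fintype σ] {ν₁ ν₂ : Measure (σ → ℝ≥0∞)} [IsFiniteMeasure ν₁]
    (h : ∀ T : σ → Set ℝ≥0∞, (∀ i, MeasurableSet (T i)) →
      ν₁ (Set.univ.pi T) = ν₂ (Set.univ.pi T)) : ν₁ = ν₂ := by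
  refine ext_of_generate_finite _ generateFrom_pi.symm isPiSystem_pi ?_ ?_
  · rintro _ ⟨T, hT, rfl⟩
    exact h T fun i => hT i (Set.mem_univ i)
  · simpa using h (fun _ => Set.univ) fun _ => MeasurableSet.univ

/-- A finite measure on the space of measures is determined by the cylinders over families of
disjoint sets, each of which is contained in `K` or in its complement. -/
theorem ext_of_cylinders {K : Set α} (hK : MeasurableSet K) {ν₁ ν₂ : Measure (Measure α)}
    [IsFiniteMeasure ν₁]
    (h : ∀ (n : ℕ) (B : Fin n → Set α) (T : Fin n → Set ℝ≥0∞), (∀ i, MeasurableSet (B i)) →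
      Pairwise (fun i j => Disjoint (B i) (B j)) → (∀ i, B i ⊆ K ∨ B i ⊆ Kᶜ) →
      (∀ i, MeasurableSet (T i)) → ν₁ (cylinderOf B T) = ν₂ (cylinderOf B T)) :
    ν₁ = ν₂ := by
  classical
  have hfin : ∀ (σ : Type _) [Fintype σ] (B : σ → Set α) (T : σ → Set ℝ≥0∞),
      (∀ i, MeasurableSet (B i)) → Pairwise (fun i j => Disjoint (B i) (B j)) →
      (∀ i, B i ⊆ K ∨ B i ⊆ Kᶜ) → (∀ i, MeasurableSet (T i)) →
      ν₁ (cylinderOf B T) = ν₂ (cylinderOf B T) := by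
    intro σ _ B T hB hd hs hT
    let e := Fintype.equivFin σ
    have key : cylinderOf B T = cylinderOf (B ∘ e.symm) (T ∘ e.symm) := by
      ext ξ
      simp only [cylinderOf, Set.mem_ofPred_eq, Function.comp]
      exact e.symm.forall_congr_right.symm
    rw [key]
    exact h _ _ _ (fun i => hB _) (fun i j hij => hd (e.symm.injective.ne hij))
      (fun i => hs _) fun i => hT _
  let m : {B : Set α // MeasurableSet B} → MeasurableSpace (Measure α) :=
    fun B => (borel ℝ≥0∞).comap fun μ => μ B.1
  have hgen : (Measure.instMeasurableSpace : MeasurableSpace (Measure α)) =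
      MeasurableSpace.generateFrom
        (piiUnionInter (fun n => {s | MeasurableSet[m n] s}) Set.univ) := by
    refine Eq.trans ?_ (generateFrom_piiUnionInter_measurableSet m Set.univ).symm
    simp only [m, Set.mem_univ, iSup_pos, iSup_subtype]
    rfl
  refine ext_of_generate_finite _ hgen
    (isPiSystem_piiUnionInter _ (fun B => @MeasurableSpace.isPiSystem_measurableSet _ (m B)) _) ?_ ?_
  · rintro _ ⟨t, -, f, hf, rfl⟩
    choose! T hT hTf using hf
    have hB : ∀ i : t, MeasurableSet (i.1.1 : Set α) := fun i => i.1.2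
    -- The sets of `t` together with `K` cut the space into disjoint atoms, each on one side of `K`.
    -- Every `ξ B` with `B ∈ t` is a finite sum of atom masses, so the event is a condition on the
    -- vector of atom masses, whose law is determined by boxes.
    let atom : (t → Bool) × Bool → Set α := fun q =>
      {x | (∀ i : t, q.1 i = decide (x ∈ i.1.1)) ∧ q.2 = decide (x ∈ K)}
    have atom_meas : ∀ q, MeasurableSet (atom q) := by
      intro q
      have hdec : ∀ (A : Set α) (b : Bool), MeasurableSet A →
          MeasurableSet {x | b = decide (x ∈ A)} := by
        intro A b hA
        cases b
        · convert hA.compl using 1; ext x; simp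
        · convert hA using 1; ext x; simp
      have : atom q = (⋂ i : t, {x | q.1 i = decide (x ∈ i.1.1)}) ∩ {x | q.2 = decide (x ∈ K)} := by
        ext x; simp [atom]
      rw [this]
      exact (MeasurableSet.iInter fun i => hdec _ _ (hB i)).inter (hdec _ _ hK)
    have atom_disj : Pairwise fun q r => Disjoint (atom q) (atom r) := by
      intro q r hqr
      refine Set.disjoint_left.2 fun x hx hx' => hqr ?_
      refine Prod.ext (funext fun i => ?_) ?_
      · rw [hx.1 i, hx'.1 i]
      · rw [hx.2, hx'.2]
    have atom_sub : ∀ q, atom q ⊆ K ∨ atom q ⊆ Kᶜ := by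
      rintro ⟨q, b⟩
      cases b
      · right; intro x hx; simpa [eq_comm] using hx.2
      · left; intro x hx; simpa [eq_comm] using hx.2
    have hsum : ∀ (ξ : Measure α) (i : t), ξ i.1.1 = ∑ q with q.1 i = true, ξ (atom q) := by
      intro ξ i
      rw [← measure_biUnion_finset (fun q _ r _ hqr => atom_disj hqr) fun q _ => atom_meas q]
      congr 1
      ext x
      simp only [Finset.mem_filter, Finset.mem_univ, true_and, Set.mem_iUnion, exists_prop]
      constructor
      · intro hx
        exact ⟨(fun j => decide (x ∈ j.1.1), decide (x ∈ K)), by simpa using hx,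
          fun j => rfl, rfl⟩
      · rintro ⟨q, hq, hx⟩
        have := hx.1 i
        rw [hq] at this
        simpa [eq_comm] using this
    let ev : Measure α → ((t → Bool) × Bool → ℝ≥0∞) := fun ξ q => ξ (atom q)
    have ev_meas : Measurable ev := measurable_pi_lambda _ fun q =>
      Measure.measurable_coe (atom_meas q)
    have hmap : ν₁.map ev = ν₂.map ev := by
      have : IsFiniteMeasure (ν₁.map ev) := inferInstance
      refine ext_of_boxes fun T hT => ?_
      rw [Measure.map_apply ev_meas (MeasurableSet.univ_pi hT),
        Measure.map_apply ev_meas (MeasurableSet.univ_pi hT)]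
      have : ev ⁻¹' Set.univ.pi T = cylinderOf atom T := by
        ext ξ; simp [ev, cylinderOf]
      rw [this]
      exact hfin _ _ _ atom_meas atom_disj atom_sub hT
    let W : Set ((t → Bool) × Bool → ℝ≥0∞) :=
      ⋂ i : t, (fun w => ∑ q with q.1 i = true, w q) ⁻¹' T i.1
    have hW : MeasurableSet W := by
      refine MeasurableSet.iInter fun i => ?_
      have : Measurable fun w : (t → Bool) × Bool → ℝ≥0∞ => ∑ q with q.1 i = true, w q :=
        Finset.measurable_sum _ fun q _ => measurable_pi_apply q
      exact this (hT i.1 i.2)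
    have hset : (⋂ x ∈ t, f x) = ev ⁻¹' W := by
      ext ξ
      simp only [Set.mem_iInter, W, Set.mem_preimage, ev]
      constructor
      · intro H i
        rw [← hsum]
        have := H i.1 i.2
        rwa [← hTf i.1 i.2] at this
      · intro H i hi
        rw [← hTf i hi]
        have := H ⟨i, hi⟩
        rwa [← hsum] at this
    rw [hset, ← Measure.map_apply ev_meas hW, ← Measure.map_apply ev_meas hW, hmap]
  -- The cylinder over the empty family is the whole space, which gives equality of total masses.
  · have := h 0 Fin.elim0 Fin.elim0 (fun i => i.elim0) (fun i => i.elim0) (fun i => i.elim0)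
      fun i => i.elim0
    simpa [cylinderOf] using this

end Cylinders

/-! ### Independence of the restrictions to a set and its complement -/

section Splice

variable {α : Type*} [MeasurableSpace α]

/-- The measure that agrees with `ξ` on `K` and with `η` off `K`. -/
noncomputable def glue (K : Set α) (q : Measure α × Measure α) : Measure α :=
  q.1.restrict K + q.2.restrict Kᶜ

theorem measurable_restrict {K : Set α} (hK : MeasurableSet K) :
    Measurable fun ξ : Measure α => ξ.restrict K := by
  refine Measure.measurable_of_measurable_coe _ fun s hs => ?_
  simp_rw [Measure.restrict_apply hs]
  exact Measure.measurable_coe (hs.inter hK)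

theorem measurable_glue {K : Set α} (hK : MeasurableSet K) : Measurable (glue K) :=
  ((measurable_restrict hK).comp measurable_fst).add
    ((measurable_restrict hK.compl).comp measurable_snd)

theorem glue_add (K : Set α) (q r : Measure α × Measure α) :
    glue K (q + r) = glue K q + glue K r := by
  simp only [glue, Prod.fst_add, Prod.snd_add, Measure.restrict_add]
  abel

theorem glue_restrict {K : Set α} (hK : MeasurableSet K) (q : Measure α × Measure α) :
    (glue K q).restrict K = q.1.restrict K := by
  rw [glue, Measure.restrict_add, Measure.restrict_restrict hK, Measure.restrict_restrict hK]
  simp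

theorem glue_restrict_compl {K : Set α} (hK : MeasurableSet K) (q : Measure α × Measure α) :
    (glue K q).restrict Kᶜ = q.2.restrict Kᶜ := by
  rw [glue, Measure.restrict_add, Measure.restrict_restrict hK.compl,
    Measure.restrict_restrict hK.compl]
  simp

theorem glue_apply_of_subset {K B : Set α} (hK : MeasurableSet K) (hB : B ⊆ K)
    (q : Measure α × Measure α) : glue K q B = q.1 B := by
  rw [← Measure.restrict_eq_self _ hB, glue_restrict hK, Measure.restrict_eq_self _ hB]

theorem glue_apply_of_subset_compl {K B : Set α} (hK : MeasurableSet K) (hB : B ⊆ Kᶜ)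
    (q : Measure α × Measure α) : glue K q B = q.2 B := by
  rw [← Measure.restrict_eq_self _ hB, glue_restrict_compl hK, Measure.restrict_eq_self _ hB]

/-- The law `L` of a random measure makes the restrictions to `K` and to `Kᶜ` independent. -/
def IsSplice (K : Set α) (L : Measure (Measure α)) : Prop :=
  (L.prod L).map (glue K) = L

/-- The event `A` only depends on the restriction of the random measure to `K`. -/
def IsLocalOn (K : Set α) (A : Set (Measure α)) : Prop :=
  ∀ ξ : Measure α, ξ.restrict K ∈ A ↔ ξ ∈ A

theorem IsLocalOn.mono {K K' : Set α} {A : Set (Measure α)} (hA : IsLocalOn K A) (h : K ⊆ K')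
    (hK : MeasurableSet K) : IsLocalOn K' A := by
  intro ξ
  rw [← hA, Measure.restrict_restrict hK, Set.inter_eq_left.2 h, hA]

theorem IsLocalOn.inter {K : Set α} {A B : Set (Measure α)} (hA : IsLocalOn K A)
    (hB : IsLocalOn K B) : IsLocalOn K (A ∩ B) :=
  fun ξ => and_congr (hA ξ) (hB ξ)

/-- After gluing, the first copy alone decides `A` and the second alone decides `B`, so `A ∩ B`
pulls back to the rectangle `A ×ˢ B`. -/
theorem IsSplice.measure_inter {K : Set α} (hK : MeasurableSet K) {L : Measure (Measure α)}
    [SFinite L] (hL : IsSplice K L) {A B : Set (Measure α)}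
    (hA : MeasurableSet A) (hB : MeasurableSet B) (hAK : IsLocalOn K A) (hBK : IsLocalOn Kᶜ B) :
    L (A ∩ B) = L A * L B := by
  have : glue K ⁻¹' (A ∩ B) = A ×ˢ B := by
    ext q
    simp only [Set.mem_preimage, Set.mem_inter_iff, Set.mem_prod]
    rw [← hAK, ← hBK, glue_restrict hK, glue_restrict_compl hK, hAK, hBK]
  conv_lhs => rw [← hL]
  rw [Measure.map_apply (measurable_glue hK) (hA.inter hB), this, Measure.prod_prod]

/-- Independent superpositions of random measures with independent restrictions have independent
restrictions. -/
theorem IsSplice.add {K : Set α} (hK : MeasurableSet K) {L₁ L₂ : Measure (Measure α)}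
    [IsProbabilityMeasure L₁] [IsProbabilityMeasure L₂] (h₁ : IsSplice K L₁)
    (h₂ : IsSplice K L₂) :
    IsSplice K ((L₁.prod L₂).map fun q => q.1 + q.2) := by
  have hadd : Measurable fun q : Measure α × Measure α => q.1 + q.2 :=
    measurable_fst.add measurable_snd
  have hg := measurable_glue hK
  have m₁ : MeasurePreserving (glue K) (L₁.prod L₁) L₁ := ⟨hg, h₁⟩
  have m₂ : MeasurePreserving (glue K) (L₂.prod L₂) L₂ := ⟨hg, h₂⟩
  have m := m₁.prod m₂
  -- Gluing is additive, so gluing two sums amounts to summing two glued pairs once the four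
  -- independent copies are regrouped by exchanging the middle two.
  let sw : (Measure α × Measure α) × (Measure α × Measure α) →
      (Measure α × Measure α) × (Measure α × Measure α) :=
    fun q => ((q.1.1, q.2.1), (q.1.2, q.2.2))
  have hsw : Measurable sw := by fun_prop
  have hswap : ((L₁.prod L₂).prod (L₁.prod L₂)).map sw = (L₁.prod L₁).prod (L₂.prod L₂) := by
    have := Measure.isProbabilityMeasure_map (μ := (L₁.prod L₂).prod (L₁.prod L₂))
      hsw.aemeasurable
    refine ext_of_generate_finite
      (C := Set.image2 (· ×ˢ ·)
        (Set.image2 (· ×ˢ ·) {s : Set (Measure α) | MeasurableSet s} {s | MeasurableSet s})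
        (Set.image2 (· ×ˢ ·) {s : Set (Measure α) | MeasurableSet s} {s | MeasurableSet s}))
      ?_ ?_ ?_ ?_
    · exact (generateFrom_eq_prod generateFrom_prod generateFrom_prod
        (isCountablySpanning_measurableSet.prod isCountablySpanning_measurableSet)
        (isCountablySpanning_measurableSet.prod isCountablySpanning_measurableSet)).symm
    · exact isPiSystem_prod.prod isPiSystem_prod
    · rintro _ ⟨_, ⟨a, ha : MeasurableSet a, b, hb : MeasurableSet b, rfl⟩, _,
        ⟨c, hc : MeasurableSet c, e, he : MeasurableSet e, rfl⟩, rfl⟩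
      rw [Measure.map_apply hsw ((ha.prod hb).prod (hc.prod he))]
      have : sw ⁻¹' ((a ×ˢ b) ×ˢ (c ×ˢ e)) = (a ×ˢ c) ×ˢ (b ×ˢ e) := by
        ext q; simp [sw]; tauto
      rw [this]
      simp only [Measure.prod_prod]
      ring
    · simp
  have hprod : ((L₁.prod L₂).map fun q => q.1 + q.2).prod ((L₁.prod L₂).map fun q => q.1 + q.2) =
      ((L₁.prod L₂).prod (L₁.prod L₂)).map (Prod.map (fun q => q.1 + q.2) fun q => q.1 + q.2) :=
    Measure.map_prod_map _ _ hadd hadd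
  rw [IsSplice, hprod, Measure.map_map hg (hadd.prodMap hadd)]
  have hcomp : glue K ∘ Prod.map (fun q : Measure α × Measure α => q.1 + q.2) (fun q => q.1 + q.2)
      = (fun q => q.1 + q.2) ∘ Prod.map (glue K) (glue K) ∘ sw := by
    funext q
    exact glue_add K (q.1.1, q.2.1) (q.1.2, q.2.2)
  rw [hcomp, ← Measure.map_map hadd ((hg.prodMap hg).comp hsw), ← Measure.map_map
    (hg.prodMap hg) hsw, hswap, m.map_eq]

end Splice

/-! ### Poisson laws: uniqueness and independent restrictions -/

section Poisson

variable {d : ℕ}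

instance isProbabilityMeasure_poissonDist (m : ℝ≥0∞) : IsProbabilityMeasure (poissonDist m) := by
  unfold poissonDist
  split_ifs
  · infer_instance
  · exact Measure.isProbabilityMeasure_map .of_discrete

/-- Makes the Poisson cylinder probabilities measurable functions of the environment when the mean
measure is random. -/
theorem measurable_poissonDist_apply {T : Set ℝ≥0∞} (hT : MeasurableSet T) :
    Measurable fun m => poissonDist m T := by
  have : (fun m => poissonDist m T) = fun m => if m = ∞ then Measure.dirac ∞ T else
      ∑' n : ℕ, ENNReal.ofReal (Real.exp (-m.toReal) * m.toReal ^ n / n.factorial) *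
        T.indicator 1 (n : ℝ≥0∞) := by
    funext m
    unfold poissonDist
    split_ifs with h
    · rfl
    · rw [Measure.map_apply .of_discrete hT, poissonMeasure,
        Measure.sum_apply _ (MeasurableSet.of_discrete)]
      refine tsum_congr fun n => ?_
      simp [Set.indicator]
      rfl
  rw [this]
  refine Measurable.ite (measurableSet_singleton _) measurable_const ?_
  refine Measurable.tsum fun n => ?_
  fun_prop

/-- The probabilities of cylinders over disjoint sets are those of a Poisson process. -/
def HasPoissonCylinders (L : Measure (Measure (Space d))) (μ : Measure (Space d)) : Prop :=
  ∀ (n : ℕ) (B : Fin n → Set (Space d)) (T : Fin n → Set ℝ≥0∞), (∀ i, MeasurableSet (B i)) →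
    Pairwise (fun i j => Disjoint (B i) (B j)) → (∀ i, MeasurableSet (T i)) →
    L (cylinderOf B T) = ∏ i, poissonDist (μ (B i)) (T i)

theorem IsPoissonLaw.hasPoissonCylinders {L : Measure (Measure (Space d))}
    {μ : Measure (Space d)} (h : IsPoissonLaw L μ) : HasPoissonCylinders L μ := by
  intro n B T hB hd hT
  have := (h.iIndepFun_eval n B hB hd).measure_inter_preimage_eq_mul (S := Finset.univ)
    (sets := T) fun i _ => hT i
  have hset : cylinderOf B T =
      ⋂ i ∈ Finset.univ, (fun ξ : Measure (Space d) => ξ (B i)) ⁻¹' T i := by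
    ext ξ; simp [cylinderOf]
  rw [hset, this]
  refine Finset.prod_congr rfl fun i _ => ?_
  rw [← h.map_eval _ (hB i), Measure.map_apply (Measure.measurable_coe (hB i)) (hT i)]

theorem HasPoissonCylinders.unique {L L' : Measure (Measure (Space d))} [IsFiniteMeasure L]
    {μ : Measure (Space d)} (h : HasPoissonCylinders L μ) (h' : HasPoissonCylinders L' μ) :
    L = L' :=
  ext_of_cylinders MeasurableSet.univ fun n B T hB hd _ hT => by
    rw [h n B T hB hd hT, h' n B T hB hd hT]

theorem HasPoissonCylinders.cylinder_fintype {L : Measure (Measure (Space d))}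
    {μ : Measure (Space d)} (h : HasPoissonCylinders L μ) {σ : Type*} [Fintype σ]
    {B : σ → Set (Space d)} {T : σ → Set ℝ≥0∞} (hB : ∀ i, MeasurableSet (B i))
    (hd : Pairwise fun i j => Disjoint (B i) (B j)) (hT : ∀ i, MeasurableSet (T i)) :
    L (cylinderOf B T) = ∏ i, poissonDist (μ (B i)) (T i) := by
  let e := Fintype.equivFin σ
  have key : cylinderOf B T = cylinderOf (B ∘ e.symm) (T ∘ e.symm) := by
    ext ξ
    simp only [cylinderOf, Set.mem_ofPred_eq, Function.comp]
    exact e.symm.forall_congr_right.symm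
  rw [key, h _ (B ∘ e.symm) (T ∘ e.symm) (fun i => hB _)
    (fun i j hij => hd (e.symm.injective.ne hij)) fun i => hT _]
  exact e.symm.prod_comp fun i => poissonDist (μ (B i)) (T i)

/-- It suffices to test cylinders whose base sets lie on one side of `K`. Gluing splits such a
cylinder into a rectangle, and the product formula factors along the same partition of the indices.
-/
theorem HasPoissonCylinders.isSplice {L : Measure (Measure (Space d))} [IsProbabilityMeasure L]
    {μ : Measure (Space d)} (h : HasPoissonCylinders L μ) {K : Set (Space d)}
    (hK : MeasurableSet K) : IsSplice K L := by
  classical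
  have := Measure.isProbabilityMeasure_map (μ := L.prod L) (measurable_glue hK).aemeasurable
  refine ext_of_cylinders hK fun n B T hB hd hs hT => ?_
  have hs' : ∀ i, ¬ B i ⊆ K → B i ⊆ Kᶜ := fun i hi => (hs i).resolve_left hi
  rw [Measure.map_apply (measurable_glue hK) (measurableSet_cylinderOf hB hT)]
  have : glue K ⁻¹' cylinderOf B T =
      cylinderOf (fun i : {i // B i ⊆ K} => B i) (fun i => T i) ×ˢ
        cylinderOf (fun i : {i // ¬ B i ⊆ K} => B i) (fun i => T i) := by
    ext q
    simp only [cylinderOf, Set.mem_preimage, Set.mem_ofPred_eq, Set.mem_prod, Subtype.forall]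
    constructor
    · intro H
      refine ⟨fun i hi => ?_, fun i hi => ?_⟩
      · rw [← glue_apply_of_subset hK hi]; exact H i
      · rw [← glue_apply_of_subset_compl hK (hs' i hi)]; exact H i
    · rintro ⟨H₁, H₂⟩ i
      by_cases hi : B i ⊆ K
      · rw [glue_apply_of_subset hK hi]; exact H₁ i hi
      · rw [glue_apply_of_subset_compl hK (hs' i hi)]; exact H₂ i hi
  rw [this, Measure.prod_prod, h n B T hB hd hT,
    h.cylinder_fintype (σ := {i // B i ⊆ K}) (B := fun i => B i) (T := fun i => T i)
      (fun i => hB i) (fun i j hij => hd (Subtype.coe_injective.ne hij)) (fun i => hT i),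
    h.cylinder_fintype (σ := {i // ¬ B i ⊆ K}) (B := fun i => B i) (T := fun i => T i)
      (fun i => hB i) (fun i j hij => hd (Subtype.coe_injective.ne hij)) (fun i => hT i)]
  exact Fintype.prod_subtype_mul_prod_subtype (fun i => B i ⊆ K)
    fun i => poissonDist (μ (B i)) (T i)

end Poisson

/-! ### Translations of measures, laws and events -/

section Shift

variable {d : ℕ}

theorem vadd_measure_def (x : Space d) (ξ : Measure (Space d)) :
    x +ᵥ ξ = ξ.map (fun y => x + y) := rfl

theorem vadd_measure_apply (x : Space d) (ξ : Measure (Space d)) (B : Set (Space d)) :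
    (x +ᵥ ξ) B = ξ ((fun y => x + y) ⁻¹' B) :=
  (MeasurableEquiv.addLeft x).map_apply B

theorem measurable_vadd_measure (x : Space d) :
    Measurable fun ξ : Measure (Space d) => x +ᵥ ξ :=
  Measure.measurable_map _ (measurable_const_add x)

theorem vadd_measure_add (x : Space d) (ξ η : Measure (Space d)) :
    x +ᵥ (ξ + η) = (x +ᵥ ξ) + (x +ᵥ η) :=
  Measure.map_add _ _ (measurable_const_add x)

theorem vadd_measure_restrict (x : Space d) (ξ : Measure (Space d)) (K : Set (Space d)) :
    (x +ᵥ ξ).restrict K = x +ᵥ ξ.restrict ((fun y => x + y) ⁻¹' K) :=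
  (MeasurableEquiv.addLeft x).restrict_map ξ K

theorem preimage_vadd_cylinderOf {n : ℕ} (x : Space d) (B : Fin n → Set (Space d))
    (T : Fin n → Set ℝ≥0∞) :
    (fun ξ : Measure (Space d) => x +ᵥ ξ) ⁻¹' cylinderOf B T =
      cylinderOf (fun i => (fun y => x + y) ⁻¹' B i) T := by
  ext ξ
  simp only [cylinderOf, Set.mem_preimage, Set.mem_ofPred_eq, vadd_measure_apply]

theorem HasPoissonCylinders.vadd {L : Measure (Measure (Space d))} {μ : Measure (Space d)}
    (h : HasPoissonCylinders L μ) (x : Space d) :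
    HasPoissonCylinders (L.map fun ξ => x +ᵥ ξ) (x +ᵥ μ) := by
  intro n B T hB hd hT
  rw [Measure.map_apply (measurable_vadd_measure x) (measurableSet_cylinderOf hB hT),
    preimage_vadd_cylinderOf, h n _ T (fun i => measurable_const_add x (hB i))
      (fun i j hij => (hd hij).preimage _) hT]
  simp only [vadd_measure_apply]

theorem IsLocalOn.preimage_vadd {K : Set (Space d)} {A : Set (Measure (Space d))}
    (hA : IsLocalOn K A) (x : Space d) :
    IsLocalOn ((fun y => x + y) ⁻¹' K) ((fun ξ : Measure (Space d) => x +ᵥ ξ) ⁻¹' A) := by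
  intro ξ
  simp only [Set.mem_preimage]
  rw [← vadd_measure_restrict, hA]

end Shift

/-! ### Convergence of dominated measures on events and on bounded functions -/

section Limits

variable {α ι : Type*} [MeasurableSpace α]

/-- Convergence of dominated measures extends from a generating `π`-system to all events. -/
theorem tendsto_measureReal_of_piSystem {l : Filter ι} {ν : Measure α} [IsFiniteMeasure ν]
    {νs : ι → Measure α} (hle : ∀ x, νs x ≤ ν) {c : ℝ} {C : Set (Set α)}
    (hgen : ‹MeasurableSpace α› = MeasurableSpace.generateFrom C) (hpi : IsPiSystem C)
    (huniv : Set.univ ∈ C)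
    (hC : ∀ A ∈ C, Tendsto (fun x => (νs x).real A) l (𝓝 (c * ν.real A)))
    {A : Set α} (hA : MeasurableSet A) :
    Tendsto (fun x => (νs x).real A) l (𝓝 (c * ν.real A)) := by
  have hfin : ∀ x, IsFiniteMeasure (νs x) := fun x => isFiniteMeasure_of_le ν (hle x)
  induction A, hA using MeasurableSpace.induction_on_inter hgen hpi with
  | empty => simpa using tendsto_const_nhds
  | basic s hs => exact hC s hs
  | compl s hsm ih =>
    simp only [measureReal_compl hsm]
    rw [mul_sub]
    exact (hC _ huniv).sub ih
  | iUnion f hfd hfm ih =>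
    have hsum : ∀ μ : Measure α, IsFiniteMeasure μ →
        HasSum (fun n => μ.real (f n)) (μ.real (⋃ n, f n)) := by
      intro μ _
      have htop : ∑' n, μ (f n) ≠ ∞ := by
        rw [← measure_iUnion hfd hfm]
        exact measure_ne_top _ _
      simp only [measureReal_def, measure_iUnion hfd hfm]
      rw [ENNReal.tsum_toReal_eq fun n => measure_ne_top _ _]
      exact (ENNReal.summable_toReal htop).hasSum
    have hν := hsum ν inferInstance
    simp_rw [fun x => (hsum (νs x) (hfin x)).tsum_eq.symm]
    rw [← hν.tsum_eq, ← tsum_mul_left]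
    -- The domination `νs x ≤ ν` provides the summable bound needed to exchange limit and series.
    refine tendsto_tsum_of_dominated_convergence hν.summable ih (Eventually.of_forall fun x n => ?_)
    rw [Real.norm_of_nonneg measureReal_nonneg]
    exact ENNReal.toReal_mono (measure_ne_top _ _) (hle x _)

theorem ofReal_real (μ : Measure α) [IsFiniteMeasure μ] (A : Set α) :
    ENNReal.ofReal (μ.real A) = μ A :=
  ENNReal.ofReal_toReal (measure_ne_top _ _)

/-- By the layer cake formula the integral of `F` is the integral over `t` of the measure of `{F >
t}`. These converge for each `t` and are dominated by their values under `ν`, so dominated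
convergence in `t` applies. -/
theorem tendsto_lintegral_of_tendsto_measureReal {l : Filter ι} [l.IsCountablyGenerated]
    {ν : Measure α} [IsFiniteMeasure ν] {νs : ι → Measure α} (hle : ∀ x, νs x ≤ ν) {c : ℝ}
    (hc : 0 ≤ c)
    (h : ∀ A, MeasurableSet A → Tendsto (fun x => (νs x).real A) l (𝓝 (c * ν.real A)))
    {F : α → ℝ≥0∞} (hF : Measurable F) (hF1 : ∀ a, F a ≤ 1) :
    Tendsto (fun x => ∫⁻ a, F a ∂νs x) l (𝓝 (ENNReal.ofReal c * ∫⁻ a, F a ∂ν)) := by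
  have hfin : ∀ x, IsFiniteMeasure (νs x) := fun x => isFiniteMeasure_of_le ν (hle x)
  have hFtop : ∀ a, F a ≠ ∞ := fun a => ne_top_of_le_ne_top ENNReal.one_ne_top (hF1 a)
  have layer : ∀ μ : Measure α, ∫⁻ a, F a ∂μ = ∫⁻ t in Set.Ioi (0 : ℝ), μ {a | t < (F a).toReal} := by
    intro μ
    rw [← lintegral_eq_lintegral_meas_lt μ (Eventually.of_forall fun a => ENNReal.toReal_nonneg)
      hF.ennreal_toReal.aemeasurable]
    exact lintegral_congr fun a => (ENNReal.ofReal_toReal (hFtop a)).symm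
  have hset : ∀ t : ℝ, MeasurableSet {a | t < (F a).toReal} := fun t =>
    measurableSet_lt measurable_const hF.ennreal_toReal
  have hmono : ∀ μ : Measure α, Measurable fun t : ℝ => μ {a | t < (F a).toReal} := fun μ =>
    Antitone.measurable fun s t hst => measure_mono fun a (ha : t < _) => lt_of_le_of_lt hst ha
  simp_rw [layer]
  rw [← lintegral_const_mul _ (hmono ν)]
  refine tendsto_lintegral_filter_of_dominated_convergence (fun t => ν {a | t < (F a).toReal})
    (Eventually.of_forall fun x => hmono _)
    (Eventually.of_forall fun x => Eventually.of_forall fun t => hle x _) ?_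
    (Eventually.of_forall fun t => ?_)
  · rw [← layer]
    refine ne_top_of_le_ne_top (measure_ne_top ν Set.univ) ?_
    calc ∫⁻ a, F a ∂ν ≤ ∫⁻ _, 1 ∂ν := lintegral_mono hF1
      _ = ν Set.univ := by simp
  · have := ENNReal.tendsto_ofReal (h _ (hset t))
    simpa only [ENNReal.ofReal_mul hc, ofReal_real] using this

end Limits

/-! ### Criteria for mixing, and ergodicity -/

section Mixing

variable {d : ℕ}

/-- Needed for dominated convergence along `‖x‖ → ∞`. -/
instance isCountablyGenerated_cobounded : (Bornology.cobounded (Space d)).IsCountablyGenerated := by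
  rw [← comap_norm_atTop]
  infer_instance

/-- The events that only depend on a bounded window. -/
def localEvents (d : ℕ) : Set (Set (Measure (Space d))) :=
  {A | MeasurableSet A ∧ ∃ R : ℝ, IsLocalOn (Metric.ball 0 R) A}

theorem isPiSystem_localEvents : IsPiSystem (localEvents d) := by
  rintro A ⟨hA, R, hR⟩ B ⟨hB, R', hR'⟩ -
  refine ⟨hA.inter hB, max R R', ?_⟩
  exact (hR.mono (Metric.ball_subset_ball (le_max_left _ _)) Metric.isOpen_ball.measurableSet).inter
    (hR'.mono (Metric.ball_subset_ball (le_max_right _ _)) Metric.isOpen_ball.measurableSet)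

theorem univ_mem_localEvents : Set.univ ∈ localEvents d :=
  ⟨MeasurableSet.univ, 0, fun _ => by simp⟩

/-- Each evaluation `ξ B` is the supremum over `n` of `ξ (B ∩ ball 0 n)`, and these only depend on
bounded windows. -/
theorem generateFrom_localEvents :
    (Measure.instMeasurableSpace : MeasurableSpace (Measure (Space d))) =
      MeasurableSpace.generateFrom (localEvents d) := by
  refine le_antisymm ?_ (MeasurableSpace.generateFrom_le fun A hA => hA.1)
  refine iSup₂_le fun B hB => ?_
  have key : Measurable[MeasurableSpace.generateFrom (localEvents d)]
      fun ξ : Measure (Space d) => ξ B := by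
    have hlim : (fun ξ : Measure (Space d) => ξ B) =
        fun ξ => ⨆ n : ℕ, ξ (B ∩ Metric.ball 0 n) := by
      funext ξ
      have hmono : Monotone fun n : ℕ => B ∩ Metric.ball (0 : Space d) n := fun m n hmn =>
        Set.inter_subset_inter_right _ (Metric.ball_subset_ball (by exact_mod_cast hmn))
      rw [← hmono.measure_iUnion, ← Set.inter_iUnion, Metric.iUnion_ball_nat, Set.inter_univ]
    rw [hlim]
    refine Measurable.iSup fun n => ?_
    intro T hT
    refine MeasurableSpace.measurableSet_generateFrom ⟨?_, n, ?_⟩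
    · exact Measure.measurable_coe (hB.inter Metric.isOpen_ball.measurableSet) hT
    · intro ξ
      simp only [Set.mem_preimage]
      rw [Measure.restrict_apply (hB.inter Metric.isOpen_ball.measurableSet),
        Set.inter_assoc, Set.inter_self]
  exact key.comap_le

/-- A stationary law is mixing as soon as it is mixing for local events. -/
theorem IsMixing.of_localEvents {Q : Measure (Measure (Space d))} [IsProbabilityMeasure Q]
    (hQ : ∀ x : Space d, Q.map (fun ξ => x +ᵥ ξ) = Q)
    (h : ∀ A ∈ localEvents d, ∀ B ∈ localEvents d,
      Tendsto (fun x : Space d => Q (A ∩ (fun ξ : Measure (Space d) => x +ᵥ ξ) ⁻¹' B))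
        (Bornology.cobounded (Space d)) (𝓝 (Q A * Q B))) : IsMixing Q := by
  have hmp : ∀ x : Space d, MeasurePreserving (fun ξ => x +ᵥ ξ) Q Q := fun x =>
    ⟨measurable_vadd_measure x, hQ x⟩
  refine ⟨⟨fun x B hB => (hmp x).measure_preimage hB.nullMeasurableSet⟩, ?_⟩
  have hreal : ∀ A ∈ localEvents d, ∀ B ∈ localEvents d,
      Tendsto (fun x : Space d => Q.real (A ∩ (fun ξ : Measure (Space d) => x +ᵥ ξ) ⁻¹' B))
        (Bornology.cobounded (Space d)) (𝓝 (Q.real A * Q.real B)) := by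
    intro A hA B hB
    have := (ENNReal.tendsto_toReal
      (ENNReal.mul_ne_top (measure_ne_top Q A) (measure_ne_top Q B))).comp (h A hA B hB)
    rwa [ENNReal.toReal_mul] at this
  -- With `B` local and fixed, the limit is extended in `A`: the measures are restrictions of `Q`,
  -- hence dominated by `Q`.
  have step₁ : ∀ A, MeasurableSet A → ∀ B ∈ localEvents d,
      Tendsto (fun x : Space d => Q.real (A ∩ (fun ξ : Measure (Space d) => x +ᵥ ξ) ⁻¹' B))
        (Bornology.cobounded (Space d)) (𝓝 (Q.real A * Q.real B)) := by
    intro A hA B hB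
    have := tendsto_measureReal_of_piSystem (ν := Q) (l := Bornology.cobounded (Space d))
      (νs := fun x => Q.restrict ((fun ξ : Measure (Space d) => x +ᵥ ξ) ⁻¹' B))
      (fun x => Measure.restrict_le_self) (c := Q.real B) generateFrom_localEvents
      isPiSystem_localEvents univ_mem_localEvents ?_ hA
    · simpa only [measureReal_restrict_apply hA, mul_comm] using this
    · intro A' hA'
      simpa only [measureReal_restrict_apply hA'.1, mul_comm] using hreal A' hA' B hB
  intro A B hA hB
  -- With `A` fixed, the limit is extended in `B`: the measures are translates of `Q.restrict A`,
  -- dominated by `Q` because `Q` is stationary.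
  have step₂ : Tendsto (fun x : Space d =>
      Q.real (A ∩ (fun ξ : Measure (Space d) => x +ᵥ ξ) ⁻¹' B))
      (Bornology.cobounded (Space d)) (𝓝 (Q.real A * Q.real B)) := by
    have happ : ∀ (x : Space d) (B' : Set (Measure (Space d))), MeasurableSet B' →
        ((Q.restrict A).map fun ξ => x +ᵥ ξ).real B' =
          Q.real (A ∩ (fun ξ : Measure (Space d) => x +ᵥ ξ) ⁻¹' B') := by
      intro x B' hB'
      rw [map_measureReal_apply (measurable_vadd_measure x) hB',
        measureReal_restrict_apply (measurable_vadd_measure x hB'), Set.inter_comm]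
    have := tendsto_measureReal_of_piSystem (ν := Q) (l := Bornology.cobounded (Space d))
      (νs := fun x => (Q.restrict A).map fun ξ => x +ᵥ ξ)
      (fun x => (Measure.map_mono Measure.restrict_le_self (measurable_vadd_measure x)).trans_eq
        (hQ x)) (c := Q.real A) generateFrom_localEvents
      isPiSystem_localEvents univ_mem_localEvents ?_ hB
    · simpa only [happ _ _ hB] using this
    · intro B' hB'
      simpa only [happ _ _ hB'.1] using step₁ A hA B' hB'
  have := ENNReal.tendsto_ofReal step₂
  simpa only [ENNReal.ofReal_mul measureReal_nonneg, ofReal_real] using this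

theorem IsMixing.map_vadd {Q : Measure (Measure (Space d))} (h : IsMixing Q) (x : Space d) :
    Q.map (fun ξ => x +ᵥ ξ) = Q := by
  ext A hA
  rw [Measure.map_apply (measurable_vadd_measure x) hA]
  exact h.stationary.measure_preimage_vadd x hA

/-- Mixing for bounded functions. -/
theorem IsMixing.tendsto_lintegral {Q : Measure (Measure (Space d))} [IsProbabilityMeasure Q]
    (h : IsMixing Q) {F G : Measure (Space d) → ℝ≥0∞} (hF : Measurable F) (hG : Measurable G)
    (hF1 : ∀ ξ, F ξ ≤ 1) (hG1 : ∀ ξ, G ξ ≤ 1) :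
    Tendsto (fun x : Space d => ∫⁻ ξ, F ξ * G (x +ᵥ ξ) ∂Q) (Bornology.cobounded (Space d))
      (𝓝 ((∫⁻ ξ, F ξ ∂Q) * ∫⁻ ξ, G ξ ∂Q)) := by
  have hint : ∀ {H : Measure (Space d) → ℝ≥0∞}, (∀ ξ, H ξ ≤ 1) → ∫⁻ ξ, H ξ ∂Q ≠ ∞ := by
    intro H hH
    refine ne_top_of_le_ne_top ENNReal.one_ne_top ?_
    calc ∫⁻ ξ, H ξ ∂Q ≤ ∫⁻ _, 1 ∂Q := lintegral_mono hH
      _ = 1 := by simp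
  -- The same two-stage extension: `F` replaces an indicator first, and then `G` does, with
  -- `Q.withDensity F ≤ Q` as domination.
  have step₁ : ∀ B, MeasurableSet B → Tendsto (fun x : Space d =>
      ∫⁻ ξ in (fun ξ : Measure (Space d) => x +ᵥ ξ) ⁻¹' B, F ξ ∂Q)
      (Bornology.cobounded (Space d)) (𝓝 (Q B * ∫⁻ ξ, F ξ ∂Q)) := by
    intro B hB
    have := tendsto_lintegral_of_tendsto_measureReal (ν := Q)
      (l := Bornology.cobounded (Space d))
      (νs := fun x => Q.restrict ((fun ξ : Measure (Space d) => x +ᵥ ξ) ⁻¹' B))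
      (fun x => Measure.restrict_le_self) (c := Q.real B) measureReal_nonneg ?_ hF hF1
    · simpa only [ofReal_real] using this
    · intro A hA
      have := (ENNReal.tendsto_toReal
        (ENNReal.mul_ne_top (measure_ne_top Q A) (measure_ne_top Q B))).comp (h.tendsto A B hA hB)
      rw [ENNReal.toReal_mul, mul_comm] at this
      simp only [measureReal_restrict_apply hA]
      exact this
  have hmeas : ∀ x : Space d, Measurable fun ξ : Measure (Space d) => x +ᵥ ξ :=
    measurable_vadd_measure
  have happ : ∀ (x : Space d) (B : Set (Measure (Space d))), MeasurableSet B →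
      ((Q.withDensity F).map fun ξ => x +ᵥ ξ) B =
        ∫⁻ ξ in (fun ξ : Measure (Space d) => x +ᵥ ξ) ⁻¹' B, F ξ ∂Q := by
    intro x B hB
    rw [Measure.map_apply (hmeas x) hB, withDensity_apply _ (hmeas x hB)]
  have hle : Q.withDensity F ≤ Q := by
    calc Q.withDensity F ≤ Q.withDensity 1 := withDensity_mono (Eventually.of_forall hF1)
      _ = Q := withDensity_one
  have := tendsto_lintegral_of_tendsto_measureReal (ν := Q)
    (l := Bornology.cobounded (Space d))
    (νs := fun x => (Q.withDensity F).map fun ξ => x +ᵥ ξ)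
    (fun x => (Measure.map_mono hle (hmeas x)).trans_eq (h.map_vadd x))
    (c := (∫⁻ ξ, F ξ ∂Q).toReal) ENNReal.toReal_nonneg ?_ hG hG1
  · rw [ENNReal.ofReal_toReal (hint hF1)] at this
    refine this.congr fun x => ?_
    rw [lintegral_map hG (hmeas x)]
    exact lintegral_withDensity_eq_lintegral_mul _ hF (hG.comp (hmeas x))
  · intro B hB
    have := (ENNReal.tendsto_toReal
      (ENNReal.mul_ne_top (measure_ne_top Q B) (hint hF1))).comp (step₁ B hB)
    rw [ENNReal.toReal_mul, mul_comm] at this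
    refine this.congr fun x => ?_
    rw [measureReal_def, happ x B hB]
    rfl

/-- The translates of a ball are eventually disjoint from another ball. -/
theorem eventually_preimage_ball_subset (R R' : ℝ) :
    ∀ᶠ x in Bornology.cobounded (Space d),
      (fun y => x + y) ⁻¹' Metric.ball 0 R' ⊆ (Metric.ball (0 : Space d) R)ᶜ := by
  have : ∀ᶠ x : Space d in Bornology.cobounded (Space d), R + R' ≤ ‖x‖ :=
    tendsto_norm_cobounded_atTop.eventually_ge_atTop _
  filter_upwards [this] with x hx y hy hy'
  simp only [Set.mem_preimage, mem_ball_zero_iff] at hy hy'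
  have : ‖x‖ ≤ ‖x + y‖ + ‖y‖ := by simpa using norm_sub_le (x + y) y
  linarith

/-- A stationary law with independent restrictions to disjoint regions is mixing. -/
theorem IsMixing.of_isSplice {Q : Measure (Measure (Space d))} [IsProbabilityMeasure Q]
    (hQ : ∀ x : Space d, Q.map (fun ξ => x +ᵥ ξ) = Q)
    (h : ∀ K : Set (Space d), MeasurableSet K → IsSplice K Q) : IsMixing Q := by
  refine IsMixing.of_localEvents hQ ?_
  rintro A ⟨hA, R, hR⟩ B ⟨hB, R', hR'⟩
  -- Once the translated window misses the other one, the probability factors exactly, so the limit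
  -- is that of an eventually constant function.
  refine tendsto_const_nhds.congr' ?_
  filter_upwards [eventually_preimage_ball_subset R R'] with x hx
  have hloc := (hR'.preimage_vadd x).mono hx
    (measurable_const_add x Metric.isOpen_ball.measurableSet)
  rw [(h _ Metric.isOpen_ball.measurableSet).measure_inter Metric.isOpen_ball.measurableSet hA
    (measurable_vadd_measure x hB) hR hloc, ← Measure.map_apply (measurable_vadd_measure x) hB,
    hQ x]

theorem IsMixing.ergodicVAdd (hd : 0 < d) {Q : Measure (Measure (Space d))}
    [IsProbabilityMeasure Q] (h : IsMixing Q) : ErgodicVAdd (Space d) (Measure (Space d)) Q := by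
  have := h.stationary
  refine ⟨fun {A} hA hinv => ?_⟩
  have : Nonempty (Fin d) := ⟨⟨0, hd⟩⟩
  -- Positive dimension makes the space unbounded, so limits at infinity are unique and mixing
  -- yields `Q A = Q A * Q A`.
  have : (Bornology.cobounded (Space d)).NeBot := inferInstance
  have hconst : ∀ x : Space d,
      Q (A ∩ (fun ξ : Measure (Space d) => x +ᵥ ξ) ⁻¹' A) = Q A := by
    intro x
    have : (A ∩ (fun ξ : Measure (Space d) => x +ᵥ ξ) ⁻¹' A : Set _) =ᵐ[Q] (A ∩ A : Set _) :=
      (ae_eq_refl A).inter (hinv x)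
    rw [measure_congr this, Set.inter_self]
  have hlim := h.tendsto A A hA hA
  simp only [hconst] at hlim
  have hsq : Q A = Q A * Q A := tendsto_nhds_unique tendsto_const_nhds hlim
  rw [eventuallyConst_set']
  rcases eq_or_ne (Q A) 0 with h0 | h0
  · left
    exact ae_eq_empty.2 h0
  · right
    have h1 : Q A = 1 := by
      have := (ENNReal.mul_right_inj h0 (measure_ne_top Q A)).1
        (show Q A * 1 = Q A * Q A by rw [mul_one]; exact hsq)
      exact this.symm
    exact ae_eq_univ_iff_measure_eq hA.nullMeasurableSet |>.2 (by simpa using h1)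

/-- A law obtained by mixing over an environment with a mixing law is mixing if the conditional
laws are equivariant and make the restrictions to disjoint regions independent. -/
theorem IsMixing.comp_kernel {L : Measure (Measure (Space d))} [IsProbabilityMeasure L]
    (hL : IsMixing L) (k : Kernel (Measure (Space d)) (Measure (Space d))) [IsMarkovKernel k]
    (hequiv : ∀ (x : Space d) (A : Set (Measure (Space d))), MeasurableSet A →
      ∀ᵐ ξ ∂L, k (x +ᵥ ξ) A = k ξ ((fun η : Measure (Space d) => x +ᵥ η) ⁻¹' A))
    (hindep : ∀ (K : Set (Space d)) (A B : Set (Measure (Space d))), MeasurableSet K →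
      MeasurableSet A → MeasurableSet B → IsLocalOn K A → IsLocalOn Kᶜ B →
      ∀ᵐ ξ ∂L, k ξ (A ∩ B) = k ξ A * k ξ B) :
    IsMixing (L.bind k) := by
  have happ : ∀ A, MeasurableSet A → L.bind k A = ∫⁻ ξ, k ξ A ∂L := fun A hA =>
    Measure.bind_apply hA k.measurable.aemeasurable
  have : IsProbabilityMeasure (L.bind k) := ⟨by rw [happ _ MeasurableSet.univ]; simp⟩
  refine IsMixing.of_localEvents ?_ ?_
  · intro x
    ext A hA
    rw [Measure.map_apply (measurable_vadd_measure x) hA, happ A hA,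
      happ _ (measurable_vadd_measure x hA), ← lintegral_congr_ae (hequiv x A hA)]
    conv_rhs => rw [← hL.map_vadd x]
    rw [lintegral_map (k.measurable_coe hA) (measurable_vadd_measure x)]
  · rintro A ⟨hA, R, hR⟩ B ⟨hB, R', hR'⟩
    -- Mixing of the environment is applied to the functions `ξ ↦ k ξ A` and `ξ ↦ k ξ B`. For far
    -- `x` the integrand `k ξ A * k (x +ᵥ ξ) B` equals the conditional probability of the
    -- intersection.
    have hlim := hL.tendsto_lintegral (k.measurable_coe hA) (k.measurable_coe hB)
      (fun ξ => prob_le_one) (fun ξ => prob_le_one)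
    rw [happ A hA, happ B hB]
    refine hlim.congr' ?_
    filter_upwards [eventually_preimage_ball_subset R R'] with x hx
    have hBx := measurable_vadd_measure x hB
    have hloc := (hR'.preimage_vadd x).mono hx
      (measurable_const_add x Metric.isOpen_ball.measurableSet)
    rw [happ _ (hA.inter hBx)]
    refine lintegral_congr_ae ?_
    filter_upwards [hequiv x B hB,
      hindep _ A _ Metric.isOpen_ball.measurableSet hA hBx hR hloc] with ξ h₁ h₂
    rw [h₁, h₂]

end Mixing

/-! ### Splicing and relabelling product measures and Bernoulli random sets -/

section Product

variable {ι κ : Type*}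

/-- Resampling the coordinates outside `J` from an independent copy does not change a product
measure: on a finite box the product splits into the factors inside and outside `J`. -/
theorem infinitePi_map_splice {X : ι → Type*} [∀ i, MeasurableSpace (X i)]
    (μ : ∀ i, Measure (X i)) [∀ i, IsProbabilityMeasure (μ i)] (J : Set ι)
    [DecidablePred (· ∈ J)] :
    ((Measure.infinitePi μ).prod (Measure.infinitePi μ)).map
      (fun q i => if i ∈ J then q.1 i else q.2 i) = Measure.infinitePi μ := by
  have hmeas : Measurable fun (q : (∀ i, X i) × (∀ i, X i)) i => if i ∈ J then q.1 i else q.2 i := by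
    refine measurable_pi_lambda _ fun i => ?_
    split_ifs
    · exact (measurable_pi_apply i).comp measurable_fst
    · exact (measurable_pi_apply i).comp measurable_snd
  refine Measure.eq_infinitePi _ fun s t ht => ?_
  rw [Measure.map_apply hmeas (.pi s.countable_toSet fun i _ => ht i)]
  have : (fun (q : (∀ i, X i) × (∀ i, X i)) i => if i ∈ J then q.1 i else q.2 i) ⁻¹'
      (s : Set ι).pi t = ((s.filter (· ∈ J) : Finset ι) : Set ι).pi t ×ˢ
        ((s.filter (· ∉ J) : Finset ι) : Set ι).pi t := by
    ext q
    simp only [Set.mem_preimage, Set.mem_pi, Finset.mem_coe, Set.mem_prod, Finset.mem_filter]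
    constructor
    · intro H
      refine ⟨fun i hi => ?_, fun i hi => ?_⟩
      · simpa [hi.2] using H i hi.1
      · simpa [hi.2] using H i hi.1
    · rintro ⟨H₁, H₂⟩ i hi
      split_ifs with h
      · exact H₁ i ⟨hi, h⟩
      · exact H₂ i ⟨hi, h⟩
  rw [this, Measure.prod_prod, Measure.infinitePi_pi _ fun i _ => ht i,
    Measure.infinitePi_pi _ fun i _ => ht i, Finset.prod_filter_mul_prod_filter_not]

theorem infinitePi_map_comp_injective {X : Type*} [MeasurableSpace X] (μ : Measure X)
    [IsProbabilityMeasure μ] {g : ι → κ} (hg : Function.Injective g) :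
    (Measure.infinitePi fun _ : κ => μ).map (fun f i => f (g i)) =
      Measure.infinitePi fun _ : ι => μ := by
  classical
  have hmeas : Measurable fun (f : κ → X) i => f (g i) := by fun_prop
  refine Measure.eq_infinitePi _ fun s t ht => ?_
  rw [Measure.map_apply hmeas (.pi s.countable_toSet fun i _ => ht i)]
  have : (fun (f : κ → X) i => f (g i)) ⁻¹' (s : Set ι).pi t =
      -- The constraint on coordinate `i` becomes one on coordinate `g i`; the default `Set.univ`
      -- off the range of `g` imposes nothing.
      ((s.image g : Finset κ) : Set κ).pi (Function.extend g t fun _ => Set.univ) := by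
    ext f
    simp [hg.extend_apply]
  have hmt : ∀ k, MeasurableSet (Function.extend g t (fun _ => Set.univ) k) := by
    intro k
    by_cases hk : ∃ i, g i = k
    · obtain ⟨i, rfl⟩ := hk
      rw [hg.extend_apply]
      exact ht i
    · rw [Function.extend_apply' _ _ _ hk]
      exact MeasurableSet.univ
  rw [this, Measure.infinitePi_pi _ fun i _ => hmt i, Finset.prod_image fun i _ j _ h => hg h]
  simp [hg.extend_apply]

variable (p : unitInterval)

instance isProbabilityMeasure_bernoulliProp (q : Prop) : IsProbabilityMeasure
    (unitInterval.toNNReal p • Measure.dirac q +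
      unitInterval.toNNReal (unitInterval.symm p) • Measure.dirac False) := by
  infer_instance

theorem setBernoulli_univ_map_preimage {g : ι → κ} (hg : Function.Injective g) :
    (setBernoulli (Set.univ : Set κ) p).map (fun s => g ⁻¹' s) =
      setBernoulli (Set.univ : Set ι) p := by
  have h₁ : Measurable fun s : Set κ => g ⁻¹' s := by
    rw [measurable_set_iff]; intro i; exact measurable_set_mem (g i)
  have h₂ : ∀ σ : Type _, Measurable fun f : σ → Prop => {i | f i} := fun σ => by
    rw [measurable_set_iff]; intro i; exact measurable_pi_apply i
  have h₂' : Measurable fun f : ι → Prop => {i | f i} := by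
    rw [measurable_set_iff]; intro i; exact measurable_pi_apply i
  rw [setBernoulli_eq_map, setBernoulli_eq_map, Measure.map_map h₁ (h₂ κ)]
  simp only [Set.mem_univ]
  rw [← infinitePi_map_comp_injective _ hg, Measure.map_map h₂' (by fun_prop)]
  rfl

theorem setBernoulli_univ_splice (J : Set ι) :
    ((setBernoulli (Set.univ : Set ι) p).prod (setBernoulli (Set.univ : Set ι) p)).map
      (fun q => q.1 ∩ J ∪ q.2 ∩ Jᶜ) = setBernoulli (Set.univ : Set ι) p := by
  classical
  have h₂ : Measurable fun f : ι → Prop => {i | f i} := by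
    rw [measurable_set_iff]; intro i; exact measurable_pi_apply i
  have h₁ : Measurable fun q : Set ι × Set ι => q.1 ∩ J ∪ q.2 ∩ Jᶜ := by
    rw [measurable_set_iff]
    intro i
    have e₁ : Measurable fun q : Set ι × Set ι => i ∈ q.1 := (measurable_set_mem i).comp measurable_fst
    have e₂ : Measurable fun q : Set ι × Set ι => i ∈ q.2 := (measurable_set_mem i).comp measurable_snd
    simp only [Set.mem_union, Set.mem_inter_iff]
    exact (e₁.and measurable_const).or (e₂.and measurable_const)
  have h₃ : Measurable fun (q : (ι → Prop) × (ι → Prop)) i => if i ∈ J then q.1 i else q.2 i := by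
    refine measurable_pi_lambda _ fun i => ?_
    split_ifs
    · exact (measurable_pi_apply i).comp measurable_fst
    · exact (measurable_pi_apply i).comp measurable_snd
  conv_rhs => rw [setBernoulli_eq_map]
  rw [← infinitePi_map_splice _ J, setBernoulli_eq_map, Measure.map_prod_map _ _ h₂ h₂,
    Measure.map_map h₁ (h₂.prodMap h₂), Measure.map_map h₂ h₃]
  congr 1
  funext q
  ext i
  by_cases hi : i ∈ J <;> simp [hi]

end Product

/-! ### Independent thinning of an indexed family of points -/

section Thinning

variable {α ι : Type*} [MeasurableSpace α]

/-- The counting measure of the points `c i`, `i ∈ s`. -/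
noncomputable def thin (c : ι → α) (s : Set ι) : Measure α :=
  Measure.sum (s.indicator fun i => Measure.dirac (c i))

theorem thin_apply (c : ι → α) (s : Set ι) {B : Set α} (hB : MeasurableSet B) :
    thin c s B = ∑' i, (s ∩ c ⁻¹' B).indicator 1 i := by
  classical
  rw [thin, Measure.sum_apply _ hB]
  refine tsum_congr fun i => ?_
  by_cases hi : i ∈ s
  · rw [Set.indicator_of_mem hi, Measure.dirac_apply' _ hB]
    by_cases hb : c i ∈ B <;> simp [hi, hb]
  · simp [hi]

theorem measurable_thin [Countable ι] (c : ι → α) : Measurable (thin c) := by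
  classical
  refine Measure.measurable_of_measurable_coe _ fun B hB => ?_
  simp only [thin_apply c _ hB]
  refine Measurable.tsum fun i => ?_
  by_cases hb : c i ∈ B
  · have : (fun s : Set ι => (s ∩ c ⁻¹' B).indicator (1 : ι → ℝ≥0∞) i) =
        Set.indicator {s : Set ι | i ∈ s} 1 := by
      funext s
      simp [Set.indicator, hb]
    rw [this]
    exact measurable_one.indicator (measurable_set_mem i).setOf
  · simp [hb]

theorem thin_splice (c : ι → α) {K : Set α} (hK : MeasurableSet K) (q : Set ι × Set ι) :
    thin c (q.1 ∩ c ⁻¹' K ∪ q.2 ∩ (c ⁻¹' K)ᶜ) = glue K (thin c q.1, thin c q.2) := by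
  classical
  ext B hB
  rw [glue, Measure.add_apply, Measure.restrict_apply hB, Measure.restrict_apply hB,
    thin_apply c _ hB, thin_apply c _ (hB.inter hK), thin_apply c _ (hB.inter hK.compl),
    ← ENNReal.tsum_add]
  refine tsum_congr fun i => ?_
  by_cases hk : c i ∈ K <;> by_cases hb : c i ∈ B <;> simp [Set.indicator, hk, hb]

/-- The law of the random counting measure of independently retained points `c i`. -/
noncomputable def thinLaw (c : ι → α) (p : unitInterval) : Measure (Measure α) :=
  (setBernoulli (Set.univ : Set ι) p).map (thin c)

/-- Gluing thinned measures along `K` is the same as splicing the retained index sets along `c ⁻¹'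
K`, which preserves the Bernoulli law. -/
theorem isSplice_thinLaw [Countable ι] (c : ι → α) (p : unitInterval) {K : Set α}
    (hK : MeasurableSet K) : IsSplice K (thinLaw c p) := by
  have h₁ : Measurable fun q : Set ι × Set ι => q.1 ∩ c ⁻¹' K ∪ q.2 ∩ (c ⁻¹' K)ᶜ := by
    rw [measurable_set_iff]
    intro i
    have e₁ : Measurable fun q : Set ι × Set ι => i ∈ q.1 := (measurable_set_mem i).comp measurable_fst
    have e₂ : Measurable fun q : Set ι × Set ι => i ∈ q.2 := (measurable_set_mem i).comp measurable_snd
    simp only [Set.mem_union, Set.mem_inter_iff]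
    exact (e₁.and measurable_const).or (e₂.and measurable_const)
  have ht := measurable_thin c
  unfold IsSplice thinLaw
  conv_rhs => rw [← setBernoulli_univ_splice p (c ⁻¹' K), Measure.map_map ht h₁]
  rw [Measure.map_prod_map _ _ ht ht, Measure.map_map (measurable_glue hK) (ht.prodMap ht)]
  congr 1
  funext q
  exact (thin_splice c hK q).symm

theorem thin_comp_injective {κ : Type*} (c : κ → α) {g : ι → κ} (hg : Function.Injective g)
    (s : Set κ) : thin (c ∘ g) (g ⁻¹' s) = thin c (s ∩ Set.range g) := by
  classical
  ext B hB
  rw [thin_apply _ _ hB, thin_apply _ _ hB, ← hg.tsum_eq]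
  · refine tsum_congr fun i => ?_
    simp [Set.indicator]
  · intro k hk
    by_contra h
    simp [h] at hk

/-- Realizes a thinning from a Bernoulli set on a larger index type. With `κ = ℕ`, the source of
randomness no longer depends on the set being thinned. -/
theorem thinLaw_comp_injective {κ : Type*} [Countable κ] (c : κ → α) {g : ι → κ}
    (hg : Function.Injective g) (p : unitInterval) :
    thinLaw (c ∘ g) p =
      (setBernoulli (Set.univ : Set κ) p).map fun s => thin c (s ∩ Set.range g) := by
  have : Countable ι := hg.countable
  have h₁ : Measurable fun s : Set κ => g ⁻¹' s := by
    rw [measurable_set_iff]; intro i; exact measurable_set_mem (g i)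
  rw [thinLaw, ← setBernoulli_univ_map_preimage p hg, Measure.map_map (measurable_thin _) h₁]
  congr 1
  funext s
  exact thin_comp_injective c hg s

theorem map_thin {β : Type*} [MeasurableSpace β] {f : α → β} (hf : Measurable f) (c : ι → α)
    (s : Set ι) : (thin c s).map f = thin (f ∘ c) s := by
  ext B hB
  rw [Measure.map_apply hf hB, thin_apply _ _ hB, thin_apply _ _ (hf hB)]
  rfl

theorem map_thinLaw {β : Type*} [MeasurableSpace β] {f : α → β} (hf : Measurable f) [Countable ι]
    (c : ι → α) (p : unitInterval) :
    (thinLaw c p).map (fun ξ => ξ.map f) = thinLaw (f ∘ c) p := by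
  rw [thinLaw, thinLaw, Measure.map_map (Measure.measurable_map f hf) (measurable_thin c)]
  congr 1
  funext s
  exact map_thin hf c s

end Thinning

/-! ### Bernoulli processes: equivariance, independence, measurable dependence on the set -/

section Bernoulli

variable {d : ℕ}

theorem bernoulliLaw_eq_thinLaw (V : Set (Space d)) (p : unitInterval) :
    bernoulliLaw V p = thinLaw (Subtype.val : V → Space d) p := rfl

theorem bernoulliLaw_vadd {V : Set (Space d)} (hV : V.Countable) (p : unitInterval)
    (x : Space d) :
    (bernoulliLaw V p).map (fun ξ => x +ᵥ ξ) = bernoulliLaw ((fun y => x + y) '' V) p := by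
  have : Countable V := hV
  have : Countable ((fun y => x + y) '' V) := hV.image _
  let g : V → (fun y => x + y) '' V := fun v => ⟨x + v, v, v.2, rfl⟩
  have hg : Function.Injective g := fun v w h => by
    simpa [g, Subtype.ext_iff] using h
  have hs : Set.range g = Set.univ := by
    refine Set.eq_univ_of_forall ?_
    rintro ⟨_, v, hv, rfl⟩
    exact ⟨⟨v, hv⟩, rfl⟩
  have := thinLaw_comp_injective (Subtype.val : (fun y => x + y) '' V → Space d) hg p
  rw [hs] at this
  simp only [Set.inter_univ] at this
  rw [bernoulliLaw_eq_thinLaw, bernoulliLaw_eq_thinLaw]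
  refine (map_thinLaw (measurable_const_add x) (Subtype.val : V → Space d) p).trans ?_
  exact this

theorem isSplice_bernoulliLaw {V : Set (Space d)} (hV : V.Countable) (p : unitInterval)
    {K : Set (Space d)} (hK : MeasurableSet K) : IsSplice K (bernoulliLaw V p) := by
  have : Countable V := hV
  exact isSplice_thinLaw _ p hK

/-- The Bernoulli process on a partially enumerated set, as a thinning of the enumeration. -/
theorem bernoulliLaw_enumeration (valid : ℕ → Prop) (c : ℕ → Space d) (p : unitInterval) :
    bernoulliLaw {v | ∃ k, valid k ∧ c k = v} p =
      (setBernoulli (Set.univ : Set ℕ) p).map fun s =>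
        thin c (s ∩ {k | valid k ∧ ∀ j < k, valid j → c j ≠ c k}) := by
  classical
  set V : Set (Space d) := {v | ∃ k, valid k ∧ c k = v}
  -- Each point is represented by its first valid index, so that repetitions in the enumeration are
  -- not counted.
  let g : V → ℕ := fun v => Nat.find v.2
  have hg : ∀ v : V, valid (g v) ∧ c (g v) = v := fun v => Nat.find_spec v.2
  have hinj : Function.Injective g := fun v w h => by
    rw [Subtype.ext_iff, ← (hg v).2, ← (hg w).2, h]
  have hrange : Set.range g = {k | valid k ∧ ∀ j < k, valid j → c j ≠ c k} := by
    ext k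
    constructor
    · rintro ⟨v, rfl⟩
      refine ⟨(hg v).1, fun j hj hv hc => ?_⟩
      exact Nat.find_min v.2 hj ⟨hv, hc.trans (hg v).2⟩
    · rintro ⟨hk, hmin⟩
      refine ⟨⟨c k, k, hk, rfl⟩, ?_⟩
      refine (Nat.find_eq_iff _).2 ⟨⟨hk, rfl⟩, fun j hj h => hmin j hj h.1 h.2⟩
  have hc : c ∘ g = (Subtype.val : V → Space d) := funext fun v => (hg v).2
  rw [bernoulliLaw_eq_thinLaw, ← hc, thinLaw_comp_injective c hinj, hrange]

/-- By the enumeration, the law at `a` is the image of one fixed measure on `Set ℕ` under a map that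
is jointly measurable in `a` and the retained set; sections of measurable sets then have measurable
mass. -/
theorem measurable_bernoulliLaw_nat {α : Type*} [MeasurableSpace α] {valid : ℕ → α → Prop}
    {c : ℕ → α → Space d} (hvalid : ∀ k, MeasurableSet {a | valid k a})
    (hc : ∀ k, Measurable (c k)) (p : unitInterval) :
    Measurable fun a => bernoulliLaw {v | ∃ k, valid k a ∧ c k a = v} p := by
  classical
  simp only [bernoulliLaw_enumeration]
  have hT : Measurable fun q : α × Set ℕ =>
      thin (fun k => c k q.1)
        (q.2 ∩ {k | valid k q.1 ∧ ∀ j < k, valid j q.1 → c j q.1 ≠ c k q.1}) := by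
    refine Measure.measurable_of_measurable_coe _ fun B hB => ?_
    simp only [thin_apply _ _ hB]
    refine Measurable.tsum fun k => ?_
    have hset : MeasurableSet {q : α × Set ℕ | (k ∈ q.2 ∧ valid k q.1 ∧
        ∀ j, j < k → valid j q.1 → c j q.1 ≠ c k q.1) ∧ c k q.1 ∈ B} := by
      have hv : ∀ j, MeasurableSet {q : α × Set ℕ | valid j q.1} := fun j =>
        measurable_fst (hvalid j)
      have h₁ : MeasurableSet {q : α × Set ℕ | k ∈ q.2} :=
        measurable_snd (measurable_set_mem k).setOf
      have h₂ : ∀ j, MeasurableSet {q : α × Set ℕ | c j q.1 ≠ c k q.1} := fun j =>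
        (measurableSet_eq_fun ((hc j).comp measurable_fst) ((hc k).comp measurable_fst)).compl
      have h₃ : MeasurableSet {q : α × Set ℕ | c k q.1 ∈ B} :=
        ((hc k).comp measurable_fst) hB
      have h₄ : MeasurableSet {q : α × Set ℕ | ∀ j, j < k → valid j q.1 → c j q.1 ≠ c k q.1} := by
        rw [Set.ofPred_forall]
        refine MeasurableSet.iInter fun j => ?_
        by_cases hj : j < k
        · simp only [hj, forall_const]
          exact MeasurableSet.imp (hv j) (h₂ j)
        · simp [hj]
      exact ((h₁.inter ((hv k).inter h₄))).inter h₃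
    have hone : Measurable fun _ : α × Set ℕ => (1 : ℝ≥0∞) := measurable_const
    have hm := hone.indicator hset
    convert hm using 1
    funext q
    simp only [Set.indicator, Set.mem_inter_iff, Set.mem_ofPred_eq, Set.mem_preimage]
    rfl
  refine Measure.measurable_of_measurable_coe _ fun A hA => ?_
  have happ : ∀ a, ((setBernoulli (Set.univ : Set ℕ) p).map fun s =>
      thin (fun k => c k a) (s ∩ {k | valid k a ∧ ∀ j < k, valid j a → c j a ≠ c k a})) A =
      setBernoulli (Set.univ : Set ℕ) p (Prod.mk a ⁻¹' ((fun q : α × Set ℕ =>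
      thin (fun k => c k q.1)
        (q.2 ∩ {k | valid k q.1 ∧ ∀ j < k, valid j q.1 → c j q.1 ≠ c k q.1})) ⁻¹' A)) := by
    intro a
    exact Measure.map_apply (hT.comp (measurable_prodMk_left (x := a))) hA
  simp only [happ]
  exact measurable_measure_prodMk_left (hT hA)

/-- The Bernoulli process on a measurably enumerated random set depends measurably on the set. -/
theorem measurable_bernoulliLaw {α σ : Type*} [MeasurableSpace α] [Countable σ]
    {valid : σ → α → Prop} {c : σ → α → Space d} (hvalid : ∀ k, MeasurableSet {a | valid k a})
    (hc : ∀ k, Measurable (c k)) (p : unitInterval) :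
    Measurable fun a => bernoulliLaw {v | ∃ k, valid k a ∧ c k a = v} p := by
  rcases isEmpty_or_nonempty σ with h | h
  · simp
  · obtain ⟨e, he⟩ := exists_surjective_nat σ
    have := measurable_bernoulliLaw_nat (fun k => hvalid (e k)) (fun k => hc (e k)) p
    simpa only [he.exists] using this

end Bernoulli

variable {d : ℕ}

/-! ### Point measures and a measurable enumeration of their points -/

section PointMeasure

/-- The masses of shrinking punctured balls decrease to `0`, and being integers they are eventually
equal to `0`. -/
theorem IsPointMeasure.exists_ball_diff {ξ : Measure (Space d)} (h : IsPointMeasure ξ)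
    (x : Space d) : ∃ r > 0, ξ (Metric.ball x r \ {x}) = 0 := by
  have := h.1
  obtain ⟨s, hs, hfin⟩ := ξ.finiteAt_nhds x
  obtain ⟨r, hr, hrs⟩ := Metric.mem_nhds_iff.1 hs
  let S : ℕ → Set (Space d) := fun n => Metric.ball x (r / (n + 1)) \ {x}
  have hanti : Antitone S := fun m n hmn => by
    refine Set.sdiff_subset_sdiff_left (Metric.ball_subset_ball ?_)
    gcongr
  have hmeas : ∀ n, MeasurableSet (S n) := fun n =>
    Metric.isOpen_ball.measurableSet.diff (measurableSet_singleton x)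
  have hinter : ⋂ n, S n = ∅ := by
    refine Set.eq_empty_of_forall_notMem fun y hy => ?_
    have hy' := fun n => Set.mem_iInter.1 hy n
    have hpos : 0 < dist y x := dist_pos.2 (hy' 0).2
    obtain ⟨n, hn⟩ := exists_nat_gt (r / dist y x)
    have h₁ : dist y x < r / (n + 1) := (hy' n).1
    rw [lt_div_iff₀ (by positivity)] at h₁
    rw [div_lt_iff₀ hpos] at hn
    nlinarith
  have hlim := tendsto_measure_iInter_atTop (μ := ξ) (fun n => (hmeas n).nullMeasurableSet) hanti
    ⟨0, ne_top_of_le_ne_top hfin.ne (measure_mono fun y hy => hrs (by simpa [S] using hy.1))⟩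
  rw [hinter, measure_empty] at hlim
  obtain ⟨n, hn⟩ := (hlim.eventually_lt_const zero_lt_one).exists
  refine ⟨r / (n + 1), by positivity, ?_⟩
  obtain ⟨k, hk⟩ := h.2 (S n) (hmeas n)
  change ξ (S n) = 0
  simp only [Function.comp_apply] at hn
  rw [hk] at hn ⊢
  have : k < 1 := by exact_mod_cast hn
  simpa using Order.lt_one_iff.1 this

/-- The points do not accumulate anywhere. This is the form in which local finiteness enters the
geometry of the tessellation. -/
theorem IsPointMeasure.isClosed_of_subset {ξ : Measure (Space d)} (h : IsPointMeasure ξ)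
    {S : Set (Space d)} (hS : S ⊆ points ξ) : IsClosed S := by
  rw [← isOpen_compl_iff, Metric.isOpen_iff]
  intro x hx
  obtain ⟨r, hr, hξ⟩ := h.exists_ball_diff x
  refine ⟨r, hr, fun y hy hyS => ?_⟩
  have hyx : y ≠ x := fun e => hx (e ▸ hyS)
  exact hS hyS (measure_mono_null
    (Set.singleton_subset_iff.2 (show y ∈ Metric.ball x r \ {x} from ⟨hy, hyx⟩)) hξ)

theorem IsPointMeasure.measure_eq_zero_iff {ξ : Measure (Space d)} (h : IsPointMeasure ξ)
    (U : Set (Space d)) : ξ U = 0 ↔ Disjoint U (points ξ) := by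
  constructor
  · intro hU
    refine Set.disjoint_left.2 fun x hx hxξ => hxξ ?_
    exact measure_mono_null (Set.singleton_subset_iff.2 hx) hU
  · intro hU
    refine measure_null_of_locally_null U fun x hx => ?_
    obtain ⟨r, hr, hξ⟩ := h.exists_ball_diff x
    refine ⟨Metric.ball x r, mem_nhdsWithin_of_mem_nhds (Metric.ball_mem_nhds x hr), ?_⟩
    have hx0 : ξ {x} = 0 := by
      by_contra hne
      exact Set.disjoint_left.1 hU hx hne
    refine measure_mono_null (t := (Metric.ball x r \ {x}) ∪ {x}) ?_ (measure_union_null hξ hx0)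
    intro y hy
    by_cases hyx : y = x
    · exact Or.inr hyx
    · exact Or.inl ⟨hy, hyx⟩

/-- Replaces the mass of a singleton by masses of open balls, which remain measurable when the
center depends on `ξ`. -/
theorem IsPointMeasure.mem_points_iff {ξ : Measure (Space d)} (h : IsPointMeasure ξ)
    (x : Space d) : x ∈ points ξ ↔ ∀ n : ℕ, ξ (Metric.ball x (1 / (n + 1))) ≠ 0 := by
  constructor
  · intro hx n h0
    exact Set.disjoint_left.1 ((h.measure_eq_zero_iff _).1 h0)
      (Metric.mem_ball_self (by positivity)) hx
  · intro hx h0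
    obtain ⟨r, hr, hξ⟩ := h.exists_ball_diff x
    obtain ⟨n, hn⟩ := exists_nat_one_div_lt hr
    refine hx n ?_
    refine measure_mono_null (t := (Metric.ball x r \ {x}) ∪ {x}) ?_ (measure_union_null hξ h0)
    intro y hy
    by_cases hyx : y = x
    · exact Or.inr hyx
    · exact Or.inl ⟨Metric.ball_subset_ball hn.le hy, hyx⟩

/-- A countable base of balls. -/
noncomputable def baseBall (d : ℕ) (q : ℕ × ℕ) : Set (Space d) :=
  Metric.ball (TopologicalSpace.denseSeq (Space d) q.1) (1 / (q.2 + 1))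

theorem exists_mem_baseBall {x : Space d} {r : ℝ} (hr : 0 < r) :
    ∃ q : ℕ × ℕ, x ∈ baseBall d q ∧
      dist (TopologicalSpace.denseSeq (Space d) q.1) x + 1 / (q.2 + 1) ≤ r := by
  obtain ⟨n, hn⟩ := exists_nat_one_div_lt (half_pos hr)
  obtain ⟨k, hk⟩ := (TopologicalSpace.denseRange_denseSeq (Space d)).exists_dist_lt x
    (ε := 1 / ((n : ℝ) + 1)) (by positivity)
  refine ⟨(k, n), hk, ?_⟩
  rw [dist_comm]
  change dist x _ + 1 / ((n : ℝ) + 1) ≤ r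
  linarith

theorem baseBall_subset_ball {q : ℕ × ℕ} {x : Space d} {r : ℝ}
    (h : dist (TopologicalSpace.denseSeq (Space d) q.1) x + 1 / (q.2 + 1) ≤ r) :
    baseBall d q ⊆ Metric.ball x r :=
  Metric.ball_subset_ball' (by linarith)

/-- An open ball is a countable union of base balls, selected by an inequality that is measurable in
center and radius. Hence emptiness of a random ball is an event. -/
theorem measure_ball_eq_zero_iff (ξ : Measure (Space d)) (y : Space d) (r : ℝ) :
    ξ (Metric.ball y r) = 0 ↔ ∀ q : ℕ × ℕ,
      dist (TopologicalSpace.denseSeq (Space d) q.1) y + 1 / (q.2 + 1) ≤ r →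
        ξ (baseBall d q) = 0 := by
  constructor
  · intro h q hq
    exact measure_mono_null (baseBall_subset_ball hq) h
  · intro h
    refine measure_mono_null (t := ⋃ q : {q : ℕ × ℕ //
      dist (TopologicalSpace.denseSeq (Space d) q.1) y + 1 / (q.2 + 1) ≤ r}, baseBall d q) ?_
      (measure_iUnion_null fun q => h q.1 q.2)
    intro x hx
    have hx' : 0 < r - dist x y := sub_pos.2 hx
    obtain ⟨q, hq, hle⟩ := exists_mem_baseBall (x := x) hx'
    refine Set.mem_iUnion.2 ⟨⟨q, ?_⟩, hq⟩
    have := dist_triangle (TopologicalSpace.denseSeq (Space d) q.1) x y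
    linarith

theorem measurableSet_measure_ball_eq_zero {α : Type*} [MeasurableSpace α]
    {ζ : α → Measure (Space d)} {y : α → Space d} {r : α → ℝ} (hζ : Measurable ζ)
    (hy : Measurable y) (hr : Measurable r) :
    MeasurableSet {a | ζ a (Metric.ball (y a) (r a)) = 0} := by
  simp only [measure_ball_eq_zero_iff]
  rw [Set.ofPred_forall]
  refine MeasurableSet.iInter fun q => ?_
  refine MeasurableSet.imp ?_ ?_
  · exact measurableSet_le ((measurable_const.dist hy).add measurable_const) hr
  · exact ((Measure.measurable_coe Metric.isOpen_ball.measurableSet).comp hζ)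
      (measurableSet_singleton 0)

/-- The barycenter of the restriction of `ξ` to a ball of the base. -/
noncomputable def nucleus (q : ℕ × ℕ) (ξ : Measure (Space d)) : Space d :=
  WithLp.toLp 2 fun i =>
    -- Subtracting the center's coordinate minus the radius makes the integrand nonnegative on the
    -- ball, so that `ENNReal.ofReal` loses nothing; the same amount is added back afterwards.
    ((∫⁻ y in baseBall d q, ENNReal.ofReal
        (y i - (TopologicalSpace.denseSeq (Space d) q.1 i - 1 / (q.2 + 1))) ∂ξ) /
      ξ (baseBall d q)).toReal + (TopologicalSpace.denseSeq (Space d) q.1 i - 1 / (q.2 + 1))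

theorem measurableSet_baseBall (q : ℕ × ℕ) : MeasurableSet (baseBall d q) :=
  Metric.isOpen_ball.measurableSet

theorem measurable_nucleus (q : ℕ × ℕ) : Measurable (nucleus (d := d) q) := by
  refine (WithLp.measurable_toLp 2 _).comp (measurable_pi_lambda _ fun i => ?_)
  refine Measurable.add_const (Measurable.ennreal_toReal (Measurable.div ?_ ?_)) _
  · refine (Measure.measurable_lintegral ?_).comp (measurable_restrict (measurableSet_baseBall q))
    fun_prop
  · exact Measure.measurable_coe (measurableSet_baseBall q)

/-- The barycenter belongs to the support of the configuration. -/
def validNucleus (q : ℕ × ℕ) (ξ : Measure (Space d)) : Prop :=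
  ∀ n : ℕ, ξ (Metric.ball (nucleus q ξ) (1 / (n + 1))) ≠ 0

theorem measurableSet_validNucleus (q : ℕ × ℕ) :
    MeasurableSet {ξ : Measure (Space d) | validNucleus q ξ} := by
  simp only [validNucleus]
  rw [Set.ofPred_forall]
  exact MeasurableSet.iInter fun n => (measurableSet_measure_ball_eq_zero measurable_id
    (measurable_nucleus q) measurable_const).compl

/-- A small enough base ball around a point of `ξ` has finite mass and contains no other point, so
its barycenter is that point. Barycenters that are not points of `ξ` are discarded by
`validNucleus`. -/
theorem IsPointMeasure.mem_points_iff_exists {ξ : Measure (Space d)} (h : IsPointMeasure ξ)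
    (x : Space d) : x ∈ points ξ ↔ ∃ q, validNucleus q ξ ∧ nucleus q ξ = x := by
  constructor
  · intro hx
    obtain ⟨r, hr, hξ⟩ := h.exists_ball_diff x
    have := h.1
    obtain ⟨s, hs, hfin⟩ := ξ.finiteAt_nhds x
    obtain ⟨r', hr', hrs⟩ := Metric.mem_nhds_iff.1 hs
    obtain ⟨q, hxq, hq⟩ := exists_mem_baseBall (x := x) (lt_min hr hr')
    have hsub := baseBall_subset_ball hq
    have h0 : ξ (baseBall d q) ≠ 0 := fun h0 =>
      Set.disjoint_left.1 ((h.measure_eq_zero_iff _).1 h0) hxq hx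
    have htop : ξ (baseBall d q) ≠ ∞ := ne_top_of_le_ne_top hfin.ne
      (measure_mono ((hsub.trans (Metric.ball_subset_ball (min_le_right _ _))).trans hrs))
    have hae : ∀ᵐ y ∂ξ.restrict (baseBall d q), y = x := by
      rw [ae_restrict_iff' (measurableSet_baseBall q), ae_iff]
      refine measure_mono_null ?_ hξ
      intro y hy
      simp only [Set.mem_ofPred_eq, Classical.not_imp] at hy
      exact ⟨Metric.ball_subset_ball (min_le_left _ _) (hsub hy.1), hy.2⟩
    have hx' : nucleus q ξ = x := by
      ext i
      have hint : ∫⁻ y in baseBall d q, ENNReal.ofReal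
          (y i - (TopologicalSpace.denseSeq (Space d) q.1 i - 1 / (q.2 + 1))) ∂ξ =
          ENNReal.ofReal (x i - (TopologicalSpace.denseSeq (Space d) q.1 i - 1 / (q.2 + 1))) *
            ξ (baseBall d q) := by
        rw [lintegral_congr_ae (g := fun _ => ENNReal.ofReal
          (x i - (TopologicalSpace.denseSeq (Space d) q.1 i - 1 / (q.2 + 1))))]
        · simp
        · filter_upwards [hae] with y hy
          rw [hy]
      have hnn : 0 ≤ x i - (TopologicalSpace.denseSeq (Space d) q.1 i - 1 / (q.2 + 1)) := by
        have h₁ : |(x - TopologicalSpace.denseSeq (Space d) q.1) i| ≤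
            ‖x - TopologicalSpace.denseSeq (Space d) q.1‖ := by
          simpa using PiLp.norm_apply_le (x - TopologicalSpace.denseSeq (Space d) q.1) i
        have h₂ : ‖x - TopologicalSpace.denseSeq (Space d) q.1‖ < 1 / (q.2 + 1) := by
          rw [← dist_eq_norm]; exact hxq
        have h₃ := neg_abs_le ((x - TopologicalSpace.denseSeq (Space d) q.1) i)
        simp only [PiLp.sub_apply] at h₁ h₃
        linarith
      simp only [nucleus]
      rw [hint, ENNReal.mul_div_cancel_right h0 htop, ENNReal.toReal_ofReal hnn]
      ring
    refine ⟨q, ?_, hx'⟩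
    rw [validNucleus, hx']
    exact (h.mem_points_iff x).1 hx
  · rintro ⟨q, hq, rfl⟩
    exact (h.mem_points_iff _).2 hq

end PointMeasure

variable {d : ℕ}

/-! ### Cramer's rule and choices of independent vectors -/

section LinearSystem

/-- The matrix whose rows are the given vectors. -/
def rowMatrix (r : Fin d → Space d) : Matrix (Fin d) (Fin d) ℝ := Matrix.of fun i j => r i j

theorem rowMatrix_mulVec (r : Fin d → Space d) (y : Space d) (i : Fin d) :
    (rowMatrix r).mulVec y i = inner ℝ (r i) y := by
  simp [rowMatrix, Matrix.mulVec, dotProduct, PiLp.inner_apply, mul_comm]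

theorem det_rowMatrix_ne_zero_iff (r : Fin d → Space d) :
    (rowMatrix r).det ≠ 0 ↔ LinearIndependent ℝ r := by
  rw [← isUnit_iff_ne_zero, ← Matrix.isUnit_iff_isUnit_det,
    ← Matrix.linearIndependent_rows_iff_isUnit]
  exact LinearMap.linearIndependent_iff (WithLp.linearEquiv 2 ℝ (Fin d → ℝ)).toLinearMap
    (LinearEquiv.ker _)

/-- The solution of the linear system `⟪r i, y⟫ = b i` (Cramer's rule). -/
noncomputable def cramerSol (r : Fin d → Space d) (b : Fin d → ℝ) : Space d :=
  WithLp.toLp 2 ((rowMatrix r).det⁻¹ • (rowMatrix r).adjugate.mulVec b)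

theorem eq_cramerSol_iff {r : Fin d → Space d} (hr : (rowMatrix r).det ≠ 0) (b : Fin d → ℝ)
    (y : Space d) : y = cramerSol r b ↔ ∀ i, inner ℝ (r i) y = b i := by
  constructor
  · rintro rfl i
    rw [← rowMatrix_mulVec]
    simp only [cramerSol, Matrix.mulVec_smul, Matrix.mulVec_mulVec, Matrix.mul_adjugate,
      Matrix.smul_mulVec, Matrix.one_mulVec]
    rw [smul_smul, inv_mul_cancel₀ hr, one_smul]
  · intro h
    have hb : b = (rowMatrix r).mulVec y := funext fun i => by rw [rowMatrix_mulVec, h i]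
    rw [cramerSol, hb, Matrix.mulVec_mulVec, Matrix.adjugate_mul, Matrix.smul_mulVec,
      Matrix.one_mulVec, smul_smul, inv_mul_cancel₀ hr, one_smul]

theorem cramerSol_add (r : Fin d → Space d) (b b' : Fin d → ℝ) :
    cramerSol r (b + b') = cramerSol r b + cramerSol r b' := by
  simp [cramerSol, Matrix.mulVec_add]

theorem cramerSol_smul (r : Fin d → Space d) (t : ℝ) (b : Fin d → ℝ) :
    cramerSol r (t • b) = t • cramerSol r b := by
  rw [cramerSol, cramerSol, Matrix.mulVec_smul, smul_comm, WithLp.toLp_smul]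

theorem continuous_rowMatrix : Continuous (rowMatrix (d := d)) :=
  continuous_matrix fun i j => by
    simp only [rowMatrix, Matrix.of_apply]
    fun_prop

theorem measurable_det_rowMatrix {α : Type*} [MeasurableSpace α] {r : α → Fin d → Space d}
    (hr : ∀ i, Measurable fun a => r a i) : Measurable fun a => (rowMatrix (r a)).det :=
  (continuous_rowMatrix.matrix_det).measurable.comp (measurable_pi_lambda _ hr)

theorem measurable_cramerSol {α : Type*} [MeasurableSpace α] {r : α → Fin d → Space d}
    {b : α → Fin d → ℝ} (hr : ∀ i, Measurable fun a => r a i)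
    (hb : ∀ i, Measurable fun a => b a i) : Measurable fun a => cramerSol (r a) (b a) := by
  refine (WithLp.measurable_toLp 2 _).comp (measurable_pi_lambda _ fun i => ?_)
  simp only [Pi.smul_apply, smul_eq_mul, Matrix.mulVec, dotProduct]
  refine (measurable_det_rowMatrix hr).inv.mul (Finset.measurable_sum _ fun j _ => ?_)
  refine Measurable.mul ?_ (hb j)
  have : Continuous fun r : Fin d → Space d => (rowMatrix r).adjugate i j :=
    (continuous_rowMatrix.matrix_adjugate).matrix_elem i j
  exact this.measurable.comp (measurable_pi_lambda _ hr)

theorem exists_linearIndependent_of_le_finrank {S : Set (Space d)} {k : ℕ}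
    (hk : k ≤ Module.finrank ℝ (Submodule.span ℝ S)) :
    ∃ f : Fin k → Space d, (∀ i, f i ∈ S) ∧ LinearIndependent ℝ f := by
  obtain ⟨f, hf, -, hli⟩ := Submodule.exists_fun_fin_finrank_span_eq ℝ S
  exact ⟨f ∘ Fin.castLE hk, fun i => hf _, hli.comp _ (Fin.castLE_injective hk)⟩

/-- The span of `m` vectors misses some basis vector. Adding it makes the `m` bisector equations of
an edge a square invertible system. -/
theorem exists_linearIndependent_cons {m : ℕ} {f : Fin m → Space (m + 1)}
    (hf : LinearIndependent ℝ f) :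
    ∃ j, LinearIndependent ℝ
      (Fin.cons (EuclideanSpace.single j 1) f : Fin (m + 1) → Space (m + 1)) := by
  by_contra! h
  have hmem : ∀ j, EuclideanSpace.single j (1 : ℝ) ∈ Submodule.span ℝ (Set.range f) := by
    intro j
    by_contra hj
    exact h j (linearIndependent_finCons.2 ⟨hf, hj⟩)
  have htop : Submodule.span ℝ (Set.range f) = ⊤ := by
    rw [eq_top_iff, ← (EuclideanSpace.basisFun (Fin (m + 1)) ℝ).toBasis.span_eq,
      Submodule.span_le]
    rintro _ ⟨j, rfl⟩
    simpa using hmem j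
  have h₁ := finrank_span_eq_card hf
  rw [htop, finrank_top, finrank_euclideanSpace_fin, Fintype.card_fin] at h₁
  omega

end LinearSystem

/-! ### Dimension of facets in terms of nearest nuclei -/

section Facets

variable {φ : Set (Space d)}

/-- The nuclei that are nearest to `y`. -/
def nearest (φ : Set (Space d)) (y : Space d) : Set (Space d) := {x ∈ φ | y ∈ cell φ x}

theorem mem_facetAt {y y' : Space d} : y' ∈ facetAt φ y ↔ nearest φ y ⊆ nearest φ y' := by
  simp only [facetAt, Set.mem_iInter]
  exact ⟨fun h x hx => ⟨hx.1, h x hx⟩, fun h x hx => (h hx).2⟩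

theorem self_mem_facetAt (y : Space d) : y ∈ facetAt φ y := mem_facetAt.2 subset_rfl

theorem dist_eq_of_mem_nearest {x x' y : Space d} (hx : x ∈ nearest φ y)
    (hx' : x' ∈ nearest φ y) : dist y x = dist y x' :=
  le_antisymm (hx.2 x' hx'.1) (hx'.2 x hx.1)

theorem dist_eq_iff_inner {x x' y : Space d} :
    dist y x = dist y x' ↔ inner ℝ (x - x') y = (‖x‖ ^ 2 - ‖x'‖ ^ 2) / 2 := by
  rw [dist_eq_norm, dist_eq_norm, ← sq_eq_sq₀ (norm_nonneg _) (norm_nonneg _),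
    norm_sub_sq_real, norm_sub_sq_real, inner_sub_left, real_inner_comm y x, real_inner_comm y x']
  constructor <;> intro h <;> linarith

/-- The other nuclei form a closed set, so if there are any, their distance to `y` is attained, and
it exceeds the minimal distance strictly. -/
theorem exists_gap (hφ : ∀ S ⊆ φ, IsClosed S) (y : Space d) :
    ∃ δ > 0, ∀ x ∈ nearest φ y, ∀ z ∈ φ, z ∉ nearest φ y → dist y x + δ ≤ dist y z := by
  have hcl : IsClosed (φ \ nearest φ y) := hφ _ Set.sdiff_subset
  rcases (φ \ nearest φ y).eq_empty_or_nonempty with he | hne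
  · refine ⟨1, one_pos, fun x _ z hz hz' => ?_⟩
    have : z ∈ φ \ nearest φ y := ⟨hz, hz'⟩
    rw [he] at this
    exact this.elim
  · obtain ⟨z₀, hz₀, hdist⟩ := hcl.exists_infDist_eq_dist hne y
    have : ∃ z ∈ φ, dist y z < dist y z₀ := by
      by_contra! h
      exact hz₀.2 ⟨hz₀.1, h⟩
    obtain ⟨z₁, hz₁, hlt⟩ := this
    refine ⟨dist y z₀ - dist y z₁, sub_pos.2 hlt, fun x hx z hz hz' => ?_⟩
    have h₁ := hx.2 z₁ hz₁
    have h₂ : dist y z₀ ≤ dist y z := hdist ▸ Metric.infDist_le_dist_of_mem ⟨hz, hz'⟩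
    linarith

/-- All points of the facet are equidistant from the nuclei nearest to `y`, so their differences are
orthogonal to differences of these nuclei. Conversely a small orthogonal displacement keeps the
equidistance, and by the gap no other nucleus becomes nearer. -/
theorem vectorSpan_facetAt (hφ : ∀ S ⊆ φ, IsClosed S) (y : Space d) :
    vectorSpan ℝ (facetAt φ y) = (vectorSpan ℝ (nearest φ y))ᗮ := by
  apply le_antisymm
  · rw [vectorSpan, Submodule.span_le]
    rintro _ ⟨a, ha, b, hb, rfl⟩
    rw [SetLike.mem_coe, Submodule.mem_orthogonal]
    intro u hu
    induction hu using Submodule.span_induction with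
    | mem u hu =>
      obtain ⟨x, hx, x', hx', rfl⟩ := hu
      have h₁ := dist_eq_iff_inner.1
        (dist_eq_of_mem_nearest (mem_facetAt.1 ha hx) (mem_facetAt.1 ha hx'))
      have h₂ := dist_eq_iff_inner.1
        (dist_eq_of_mem_nearest (mem_facetAt.1 hb hx) (mem_facetAt.1 hb hx'))
      simp only [vsub_eq_sub]
      rw [inner_sub_right, h₁, h₂, sub_self]
    | zero => simp
    | add u v _ _ hu hv => rw [inner_add_left, hu, hv, add_zero]
    | smul c u _ hu => rw [inner_smul_left, hu, mul_zero]
  · intro w hw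
    rw [Submodule.mem_orthogonal] at hw
    obtain ⟨δ, hδ, hgap⟩ := exists_gap hφ y
    -- This makes `‖t • w‖ ≤ δ / 2`; two triangle inequalities then consume at most the gap `δ`. The
    -- `+ 1` covers `w = 0`.
    set t : ℝ := δ / (2 * (‖w‖ + 1)) with ht
    have htpos : 0 < t := by positivity
    have htw : ‖t • w‖ ≤ δ / 2 := by
      rw [norm_smul, Real.norm_of_nonneg htpos.le, ht, div_mul_eq_mul_div, div_le_div_iff₀
        (by positivity) (by positivity)]
      nlinarith [norm_nonneg w]
    have hmem : y + t • w ∈ facetAt φ y := by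
      rw [mem_facetAt]
      refine fun x hx => ⟨hx.1, fun z hz => ?_⟩
      by_cases hzn : z ∈ nearest φ y
      · refine (dist_eq_iff_inner.2 ?_).le
        rw [inner_add_right, inner_smul_right, hw (x - z) (vsub_mem_vectorSpan ℝ hx hzn), mul_zero,
          add_zero]
        exact dist_eq_iff_inner.1 (dist_eq_of_mem_nearest hx hzn)
      · have h₁ := hgap x hx z hz hzn
        have h₂ : dist (y + t • w) y ≤ δ / 2 := by simpa [dist_eq_norm] using htw
        have h₃ := dist_triangle (y + t • w) y x
        have h₄ := dist_triangle y (y + t • w) z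
        rw [dist_comm y (y + t • w)] at h₄
        linarith
    have := vsub_mem_vectorSpan ℝ hmem (self_mem_facetAt y)
    simp only [vsub_eq_sub, add_sub_cancel_left] at this
    exact (Submodule.smul_mem_iff _ htpos.ne').1 this

theorem finrank_vectorSpan_facetAt (hφ : ∀ S ⊆ φ, IsClosed S) (y : Space d) :
    Module.finrank ℝ (vectorSpan ℝ (nearest φ y)) +
      Module.finrank ℝ (vectorSpan ℝ (facetAt φ y)) = d := by
  rw [vectorSpan_facetAt hφ, Submodule.finrank_add_finrank_orthogonal, finrank_euclideanSpace_fin]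

theorem mem_crossroads_iff (hφ : ∀ S ⊆ φ, IsClosed S) (y : Space d) :
    y ∈ crossroads φ ↔ Module.finrank ℝ (vectorSpan ℝ (nearest φ y)) = d := by
  constructor
  · rintro ⟨_, ⟨⟨y₀, rfl⟩, h0⟩, hy⟩
    have hsub : (facetAt φ y₀).Subsingleton := by
      rw [← vectorSpan_eq_bot_iff_subsingleton ℝ]
      exact Submodule.finrank_eq_zero.1 h0
    obtain rfl : y = y₀ := hsub hy (self_mem_facetAt y₀)
    have := finrank_vectorSpan_facetAt hφ y
    omega
  · intro h
    have := finrank_vectorSpan_facetAt hφ y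
    exact ⟨_, ⟨⟨y, rfl⟩, by omega⟩, self_mem_facetAt y⟩

/-- Only an inequality holds, because the facets are closed: the set of nearest nuclei may grow at
the end of an edge. By `mem_streets_of_finrank` the case of equality is sufficient, and the
difference consists of vertices. -/
theorem le_finrank_of_mem_streets (hφ : ∀ S ⊆ φ, IsClosed S) {y : Space d}
    (hy : y ∈ streets φ) : d ≤ Module.finrank ℝ (vectorSpan ℝ (nearest φ y)) + 1 := by
  obtain ⟨_, ⟨⟨y₀, rfl⟩, h1⟩, hy⟩ := hy
  have h := finrank_vectorSpan_facetAt hφ y₀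
  have := Submodule.finrank_mono (vectorSpan_mono ℝ (mem_facetAt.1 hy))
  omega

theorem mem_streets_of_finrank (hφ : ∀ S ⊆ φ, IsClosed S) {y : Space d}
    (hy : Module.finrank ℝ (vectorSpan ℝ (nearest φ y)) + 1 = d) : y ∈ streets φ := by
  have h := finrank_vectorSpan_facetAt hφ y
  exact ⟨_, ⟨⟨y, rfl⟩, by omega⟩, self_mem_facetAt y⟩

/-- Turns a rank condition into the existence of finitely many nuclei, hence into a countable union
over tuples of indices. Positivity of `k` excludes an empty `N`. -/
theorem le_finrank_vectorSpan_iff {k : ℕ} (hk : 0 < k) {N : Set (Space d)} :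
    k ≤ Module.finrank ℝ (vectorSpan ℝ N) ↔ ∃ x₀ ∈ N, ∃ x : Fin k → Space d, (∀ i, x i ∈ N) ∧
      LinearIndependent ℝ fun i => x i - x₀ := by
  constructor
  · intro h
    have hne : N.Nonempty := by
      by_contra hne
      rw [Set.not_nonempty_iff_eq_empty] at hne
      rw [hne, vectorSpan_empty, finrank_bot] at h
      omega
    obtain ⟨x₀, hx₀⟩ := hne
    rw [vectorSpan_eq_span_vsub_set_right ℝ hx₀] at h
    obtain ⟨f, hf, hli⟩ := exists_linearIndependent_of_le_finrank h
    choose x hx hxf using hf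
    refine ⟨x₀, hx₀, x, hx, ?_⟩
    have : (fun i => x i - x₀) = f := funext hxf
    rwa [this]
  · rintro ⟨x₀, hx₀, x, hx, hli⟩
    have h := finrank_span_eq_card hli
    rw [Fintype.card_fin] at h
    rw [← h]
    refine Submodule.finrank_mono (Submodule.span_le.2 ?_)
    rintro _ ⟨i, rfl⟩
    exact vsub_mem_vectorSpan ℝ (hx i) hx₀

end Facets

/-! ### Measurable enumeration of the vertices -/

section Vertices

variable {d : ℕ}

theorem IsPointMeasure.mem_nearest_iff {ξ : Measure (Space d)} (h : IsPointMeasure ξ)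
    (x y : Space d) :
    x ∈ nearest (points ξ) y ↔ x ∈ points ξ ∧ ξ (Metric.ball y (dist y x)) = 0 := by
  rw [h.measure_eq_zero_iff, Set.disjoint_right]
  simp only [Metric.mem_ball, not_lt, dist_comm _ y]
  rfl

theorem mem_nearest_of_dist_eq {φ : Set (Space d)} {x x' y : Space d} (hx : x ∈ nearest φ y)
    (hx' : x' ∈ φ) (h : dist y x' = dist y x) : x' ∈ nearest φ y :=
  ⟨hx', fun z hz => h.trans_le (hx.2 z hz)⟩

/-- Right-hand side of the linear equation of the bisector of two nuclei. -/
noncomputable def bisectorConst (q₀ q : ℕ × ℕ) (ξ : Measure (Space d)) : ℝ :=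
  (‖nucleus q ξ‖ ^ 2 - ‖nucleus q₀ ξ‖ ^ 2) / 2

theorem measurable_bisectorConst (q₀ q : ℕ × ℕ) : Measurable (bisectorConst (d := d) q₀ q) :=
  (((measurable_nucleus q).norm.pow_const 2).sub
    ((measurable_nucleus q₀).norm.pow_const 2)).div_const 2

/-- The normals of the bisectors of the nucleus `τ.1` and the nuclei `τ.2 i`. -/
noncomputable def vertexRows (τ : (ℕ × ℕ) × (Fin d → ℕ × ℕ)) (ξ : Measure (Space d)) :
    Fin d → Space d := fun i => nucleus (τ.2 i) ξ - nucleus τ.1 ξ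

/-- The circumcenter of `d + 1` nuclei. -/
noncomputable def vertexPoint (τ : (ℕ × ℕ) × (Fin d → ℕ × ℕ)) (ξ : Measure (Space d)) : Space d :=
  cramerSol (vertexRows τ ξ) fun i => bisectorConst τ.1 (τ.2 i) ξ

/-- The chosen nuclei are affinely independent and their circumscribed ball is empty. -/
def validVertex (τ : (ℕ × ℕ) × (Fin d → ℕ × ℕ)) (ξ : Measure (Space d)) : Prop :=
  (validNucleus τ.1 ξ ∧ ∀ i, validNucleus (τ.2 i) ξ) ∧ (rowMatrix (vertexRows τ ξ)).det ≠ 0 ∧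
    ξ (Metric.ball (vertexPoint τ ξ) (dist (vertexPoint τ ξ) (nucleus τ.1 ξ))) = 0

theorem measurable_vertexRows (τ : (ℕ × ℕ) × (Fin d → ℕ × ℕ)) (i : Fin d) :
    Measurable fun ξ : Measure (Space d) => vertexRows τ ξ i :=
  (measurable_nucleus _).sub (measurable_nucleus _)

theorem measurable_vertexPoint (τ : (ℕ × ℕ) × (Fin d → ℕ × ℕ)) :
    Measurable (vertexPoint (d := d) τ) :=
  measurable_cramerSol (measurable_vertexRows τ) fun _ => measurable_bisectorConst _ _

theorem measurableSet_validVertex (τ : (ℕ × ℕ) × (Fin d → ℕ × ℕ)) :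
    MeasurableSet {ξ : Measure (Space d) | validVertex τ ξ} := by
  have h₁ : MeasurableSet {ξ : Measure (Space d) | ∀ i, validNucleus (τ.2 i) ξ} := by
    rw [Set.ofPred_forall]
    exact MeasurableSet.iInter fun i => measurableSet_validNucleus _
  have h₂ : MeasurableSet {ξ : Measure (Space d) | (rowMatrix (vertexRows τ ξ)).det ≠ 0} :=
    ((measurable_det_rowMatrix (measurable_vertexRows τ)) (measurableSet_singleton 0)).compl
  have h₃ := measurableSet_measure_ball_eq_zero measurable_id (measurable_vertexPoint τ)
    ((measurable_vertexPoint τ).dist (measurable_nucleus τ.1))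
  exact ((measurableSet_validNucleus _).inter h₁).inter (h₂.inter h₃)

/-- A vertex has `d + 1` affinely independent nearest nuclei. It is the unique solution of their `d`
bisector equations, and the nuclei are nearest exactly when the open circumscribed ball is empty. -/
theorem IsPointMeasure.crossroads_eq (hd : 0 < d) {ξ : Measure (Space d)}
    (h : IsPointMeasure ξ) :
    crossroads (points ξ) = {y | ∃ τ, validVertex τ ξ ∧ vertexPoint τ ξ = y} := by
  ext y
  have hle : Module.finrank ℝ (vectorSpan ℝ (nearest (points ξ) y)) ≤ d := by
    simpa using Submodule.finrank_le (vectorSpan ℝ (nearest (points ξ) y))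
  rw [mem_crossroads_iff (fun S hS => h.isClosed_of_subset hS), Set.mem_ofPred_eq,
    show Module.finrank ℝ (vectorSpan ℝ (nearest (points ξ) y)) = d ↔
      d ≤ Module.finrank ℝ (vectorSpan ℝ (nearest (points ξ) y)) by omega,
    le_finrank_vectorSpan_iff hd]
  constructor
  · rintro ⟨x₀, hx₀, x, hx, hli⟩
    obtain ⟨q₀, hq₀, hqx₀⟩ := (h.mem_points_iff_exists x₀).1 hx₀.1
    choose q hq hqx using fun i => (h.mem_points_iff_exists (x i)).1 (hx i).1
    have hrows : vertexRows (q₀, q) ξ = fun i => x i - x₀ := by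
      funext i; simp [vertexRows, hqx, hqx₀]
    have hdet : (rowMatrix (vertexRows (q₀, q) ξ)).det ≠ 0 := by
      rw [det_rowMatrix_ne_zero_iff, hrows]; exact hli
    have hy : y = vertexPoint (q₀, q) ξ := by
      rw [vertexPoint, eq_cramerSol_iff hdet]
      intro i
      simp only [hrows, bisectorConst, hqx, hqx₀]
      exact dist_eq_iff_inner.1 (dist_eq_of_mem_nearest (hx i) hx₀)
    refine ⟨(q₀, q), ⟨⟨hq₀, hq⟩, hdet, ?_⟩, hy.symm⟩
    rw [← hy]
    simp only [hqx₀]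
    exact ((h.mem_nearest_iff _ _).1 hx₀).2
  · rintro ⟨⟨q₀, q⟩, ⟨⟨hq₀, hq⟩, hdet, hball⟩, rfl⟩
    have hmem : ∀ q', validNucleus q' ξ → nucleus q' ξ ∈ points ξ := fun q' hq' =>
      (h.mem_points_iff_exists _).2 ⟨q', hq', rfl⟩
    have hx₀ := (h.mem_nearest_iff _ _).2 ⟨hmem q₀ hq₀, hball⟩
    refine ⟨nucleus q₀ ξ, hx₀, fun i => nucleus (q i) ξ, fun i => ?_, ?_⟩
    · refine mem_nearest_of_dist_eq hx₀ (hmem _ (hq i)) (dist_eq_iff_inner.2 ?_)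
      exact (eq_cramerSol_iff hdet _ _).1 rfl i
    · exact (det_rowMatrix_ne_zero_iff _).1 hdet

theorem IsPointMeasure.countable_crossroads (hd : 0 < d) {ξ : Measure (Space d)}
    (h : IsPointMeasure ξ) : (crossroads (points ξ)).Countable := by
  rw [h.crossroads_eq hd]
  refine (Set.countable_range fun τ => vertexPoint τ ξ).mono ?_
  rintro _ ⟨τ, -, rfl⟩
  exact ⟨τ, rfl⟩

/-- The Bernoulli process on the vertices is a measurable function of the nuclei. -/
theorem exists_measurable_bernoulliLaw_crossroads (hd : 0 < d) (p : unitInterval) :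
    ∃ b : Measure (Space d) → Measure (Measure (Space d)), Measurable b ∧
      ∀ ξ, IsPointMeasure ξ → b ξ = bernoulliLaw (crossroads (points ξ)) p := by
  refine ⟨fun ξ => bernoulliLaw {y | ∃ τ, validVertex τ ξ ∧ vertexPoint τ ξ = y} p,
    measurable_bernoulliLaw measurableSet_validVertex measurable_vertexPoint p,
    fun ξ hξ => by rw [hξ.crossroads_eq hd]⟩

end Vertices

/-! ### Length of measurable families of line pieces -/

section Hausdorff

variable {E α : Type*} [NormedAddCommGroup E] [NormedSpace ℝ E] [MeasurableSpace E] [BorelSpace E]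
  [MeasurableSpace α]

theorem hausdorffMeasure_inter_line (a v : E) {S : Set E} (hS : ∀ y ∈ S, ∃ t : ℝ, y = a + t • v) :
    μH[1] S = ‖v‖₊ • volume {t : ℝ | a + t • v ∈ S} := by
  have : S = (fun y => a + y) '' ((fun t : ℝ => t • v) '' {t : ℝ | a + t • v ∈ S}) := by
    ext y
    simp only [Set.image_image, Set.mem_image, Set.mem_ofPred_eq]
    constructor
    · intro hy
      obtain ⟨t, rfl⟩ := hS y hy
      exact ⟨t, hy, rfl⟩
    · rintro ⟨t, ht, rfl⟩
      exact ht
  conv_lhs => rw [this]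
  rw [show (fun y => a + y) = IsometryEquiv.addLeft a from rfl,
    (IsometryEquiv.addLeft a).isometry.hausdorffMeasure_image (Or.inl zero_le_one),
    hausdorffMeasure_smul_right_image, hausdorffMeasure_real]

/-- The length of the sections of a countable union of measurable pieces of measurable families of
lines is measurable. -/
theorem measurable_hausdorffMeasure_lines [SecondCountableTopology E] {F : ℕ → Set (α × E)}
    (hF : ∀ n, MeasurableSet (F n)) {a v : ℕ → α → E} (ha : ∀ n, Measurable (a n))
    (hv : ∀ n, Measurable (v n)) (hline : ∀ n q, q ∈ F n → ∃ t : ℝ, q.2 = a n q.1 + t • v n q.1) :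
    Measurable fun x => μH[1] {y : E | ∃ n, (x, y) ∈ F n} := by
  have hD : ∀ n, MeasurableSet (disjointed F n) := fun n => MeasurableSet.disjointed hF n
  have hsec : ∀ x n, MeasurableSet {y | (x, y) ∈ disjointed F n} := fun x n =>
    measurable_prodMk_left (hD n)
  -- `μH[1]` need not be σ-finite on `E`, so measurability of section masses is obtained on the
  -- parameter line, where the measure is Lebesgue measure scaled by `‖v n x‖`. Disjoint pieces make
  -- the total length a sum.
  have key : ∀ x, μH[1] {y : E | ∃ n, (x, y) ∈ F n} =
      ∑' n, ‖v n x‖₊ • volume {t : ℝ | (x, a n x + t • v n x) ∈ disjointed F n} := by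
    intro x
    have : {y : E | ∃ n, (x, y) ∈ F n} = ⋃ n, {y | (x, y) ∈ disjointed F n} := by
      ext y
      have := Set.ext_iff.1 (iUnion_disjointed (f := F)) (x, y)
      simp only [Set.mem_iUnion] at this
      simp only [Set.mem_ofPred_eq, Set.mem_iUnion]
      exact this.symm
    rw [this, measure_iUnion (fun m n hmn => ?_) (hsec x)]
    · refine tsum_congr fun n => ?_
      rw [hausdorffMeasure_inter_line (a n x) (v n x)]
      · rfl
      · exact fun y hy => hline n (x, y) (disjointed_subset F n hy)
    · exact Set.disjoint_left.2 fun y hy hy' =>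
        Set.disjoint_left.1 (disjoint_disjointed F hmn) hy hy'
  simp only [key]
  refine Measurable.tsum fun n => ?_
  have hvol : Measurable fun x => volume {t : ℝ | (x, a n x + t • v n x) ∈ disjointed F n} := by
    have hmap : Measurable fun q : α × ℝ => (q.1, a n q.1 + q.2 • v n q.1) :=
      measurable_fst.prodMk (((ha n).comp measurable_fst).add
        (measurable_snd.smul ((hv n).comp measurable_fst)))
    exact measurable_measure_prodMk_left (hmap (hD n))
  simp only [ENNReal.smul_def, smul_eq_mul]
  exact (hv n).nnnorm.coe_nnreal_ennreal.mul hvol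

end Hausdorff

/-! ### Edge pieces and measurability of the edge length measure -/

section Edges

variable {m : ℕ}

/-- The normals of bisectors, completed by a vector of the standard basis. -/
noncomputable def edgeRows (τ : (ℕ × ℕ) × (Fin m → ℕ × ℕ) × Fin (m + 1))
    (ξ : Measure (Space (m + 1))) : Fin (m + 1) → Space (m + 1) :=
  Fin.cons (EuclideanSpace.single τ.2.2 1) fun i => nucleus (τ.2.1 i) ξ - nucleus τ.1 ξ

theorem measurable_edgeRows (τ : (ℕ × ℕ) × (Fin m → ℕ × ℕ) × Fin (m + 1)) (i : Fin (m + 1)) :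
    Measurable fun ξ : Measure (Space (m + 1)) => edgeRows τ ξ i := by
  refine Fin.cases ?_ (fun i => ?_) i
  · exact measurable_const
  · exact (measurable_nucleus _).sub (measurable_nucleus _)

/-- The points that have the chosen nuclei among their nearest ones. -/
def edgePiece (τ : (ℕ × ℕ) × (Fin m → ℕ × ℕ) × Fin (m + 1)) :
    Set (Measure (Space (m + 1)) × Space (m + 1)) :=
  {q | (validNucleus τ.1 q.1 ∧ ∀ i, validNucleus (τ.2.1 i) q.1) ∧
    (rowMatrix (edgeRows τ q.1)).det ≠ 0 ∧
    (∀ i, inner ℝ (nucleus (τ.2.1 i) q.1 - nucleus τ.1 q.1) q.2 =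
      bisectorConst τ.1 (τ.2.1 i) q.1) ∧
    q.1 (Metric.ball q.2 (dist q.2 (nucleus τ.1 q.1))) = 0}

theorem measurableSet_edgePiece (τ : (ℕ × ℕ) × (Fin m → ℕ × ℕ) × Fin (m + 1)) :
    MeasurableSet (edgePiece τ) := by
  have h₁ : ∀ q, MeasurableSet
      {s : Measure (Space (m + 1)) × Space (m + 1) | validNucleus q s.1} := fun q =>
    measurable_fst (measurableSet_validNucleus q)
  have h₂ : MeasurableSet {s : Measure (Space (m + 1)) × Space (m + 1) |
      ∀ i, validNucleus (τ.2.1 i) s.1} := by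
    rw [Set.ofPred_forall]
    exact MeasurableSet.iInter fun i => h₁ _
  have h₃ : MeasurableSet {s : Measure (Space (m + 1)) × Space (m + 1) |
      (rowMatrix (edgeRows τ s.1)).det ≠ 0} :=
    measurable_fst
      ((measurable_det_rowMatrix (measurable_edgeRows τ)) (measurableSet_singleton 0)).compl
  have hn : ∀ q, Measurable fun s : Measure (Space (m + 1)) × Space (m + 1) => nucleus q s.1 :=
    fun q => (measurable_nucleus q).comp measurable_fst
  have h₄ : MeasurableSet {s : Measure (Space (m + 1)) × Space (m + 1) |
      ∀ i, inner ℝ (nucleus (τ.2.1 i) s.1 - nucleus τ.1 s.1) s.2 =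
        bisectorConst τ.1 (τ.2.1 i) s.1} := by
    rw [Set.ofPred_forall]
    exact MeasurableSet.iInter fun i => measurableSet_eq_fun
      (((hn _).sub (hn _)).inner measurable_snd)
      ((measurable_bisectorConst _ _).comp measurable_fst)
  have h₅ := measurableSet_measure_ball_eq_zero
    (measurable_fst (α := Measure (Space (m + 1))) (β := Space (m + 1))) measurable_snd
    (measurable_snd.dist (hn τ.1))
  exact ((h₁ _).inter h₂).inter (h₃.inter (h₄.inter h₅))

theorem exists_line_of_mem_edgePiece (τ : (ℕ × ℕ) × (Fin m → ℕ × ℕ) × Fin (m + 1))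
    (q : Measure (Space (m + 1)) × Space (m + 1)) (hq : q ∈ edgePiece τ) :
    ∃ t : ℝ, q.2 =
      cramerSol (edgeRows τ q.1) (Fin.cons 0 fun i => bisectorConst τ.1 (τ.2.1 i) q.1) +
        t • cramerSol (edgeRows τ q.1) (Fin.cons 1 0) := by
  obtain ⟨-, hdet, hin, -⟩ := hq
  -- The completing row reads off the coordinate `τ.2.2`, which therefore parametrizes the line;
  -- linearity of `cramerSol` separates base point and direction.
  refine ⟨q.2 τ.2.2, ?_⟩
  rw [← cramerSol_smul, ← cramerSol_add, eq_cramerSol_iff hdet]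
  intro i
  refine Fin.cases ?_ (fun i => ?_) i
  · simp [edgeRows, PiLp.inner_apply]
  · simpa [edgeRows] using hin i

theorem IsPointMeasure.exists_mem_edgePiece_iff (hm : 0 < m) {ξ : Measure (Space (m + 1))}
    (h : IsPointMeasure ξ) (y : Space (m + 1)) :
    (∃ τ, (ξ, y) ∈ edgePiece τ) ↔
      m ≤ Module.finrank ℝ (vectorSpan ℝ (nearest (points ξ) y)) := by
  rw [le_finrank_vectorSpan_iff hm]
  constructor
  · rintro ⟨⟨q₀, q, j⟩, ⟨hq₀, hq⟩, hdet, hin, hball⟩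
    have hmem : ∀ q', validNucleus q' ξ → nucleus q' ξ ∈ points ξ := fun q' hq' =>
      (h.mem_points_iff_exists _).2 ⟨q', hq', rfl⟩
    have hx₀ := (h.mem_nearest_iff _ _).2 ⟨hmem q₀ hq₀, hball⟩
    refine ⟨nucleus q₀ ξ, hx₀, fun i => nucleus (q i) ξ, fun i => ?_, ?_⟩
    · exact mem_nearest_of_dist_eq hx₀ (hmem _ (hq i)) (dist_eq_iff_inner.2 (hin i))
    · exact (linearIndependent_finCons.1 ((det_rowMatrix_ne_zero_iff _).1 hdet)).1
  · rintro ⟨x₀, hx₀, x, hx, hli⟩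
    obtain ⟨q₀, hq₀, hqx₀⟩ := (h.mem_points_iff_exists x₀).1 hx₀.1
    choose q hq hqx using fun i => (h.mem_points_iff_exists (x i)).1 (hx i).1
    obtain ⟨j, hj⟩ := exists_linearIndependent_cons hli
    refine ⟨(q₀, q, j), ⟨hq₀, hq⟩, ?_, fun i => ?_, ?_⟩
    · rw [det_rowMatrix_ne_zero_iff]
      simpa only [edgeRows, hqx, hqx₀] using hj
    · simp only [hqx, hqx₀, bisectorConst]
      exact dist_eq_iff_inner.1 (dist_eq_of_mem_nearest (hx i) hx₀)
    · simp only [hqx₀]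
      exact ((h.mem_nearest_iff _ _).1 hx₀).2

/-- The edge length measure is a measurable function of the nuclei. -/
theorem exists_measurable_edgeLength (hm : 0 < m) :
    ∃ Λ : Measure (Space (m + 1)) → Measure (Space (m + 1)), Measurable Λ ∧
      ∀ ξ, IsPointMeasure ξ → Λ ξ = edgeLength ξ := by
  refine ⟨fun ξ => (μH[1]).restrict {y | ∃ τ, (ξ, y) ∈ edgePiece τ}, ?_, fun ξ hξ => ?_⟩
  · obtain ⟨e, he⟩ := exists_surjective_nat ((ℕ × ℕ) × (Fin m → ℕ × ℕ) × Fin (m + 1))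
    refine Measure.measurable_of_measurable_coe _ fun B hB => ?_
    have hcons : ∀ {f : Measure (Space (m + 1)) → ℝ}
        {g : Fin m → Measure (Space (m + 1)) → ℝ}, Measurable f → (∀ i, Measurable (g i)) →
        ∀ i, Measurable fun ξ => (Fin.cons (f ξ) (fun i => g i ξ) : Fin (m + 1) → ℝ) i := by
      intro f g hf hg i
      refine Fin.cases ?_ (fun i => ?_) i
      · exact hf
      · exact hg i
    have key := measurable_hausdorffMeasure_lines
      (F := fun n => edgePiece (e n) ∩ Prod.snd ⁻¹' B)
      (fun n => (measurableSet_edgePiece (e n)).inter (measurable_snd hB))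
      (fun n => measurable_cramerSol (measurable_edgeRows (e n)) (hcons measurable_const fun i =>
        measurable_bisectorConst (e n).1 ((e n).2.1 i)))
      (fun n => measurable_cramerSol (measurable_edgeRows (e n))
        (b := fun _ => Fin.cons 1 0) (fun i => measurable_const))
      (fun n q hq => exists_line_of_mem_edgePiece (e n) q hq.1)
    convert key using 1
    funext ξ
    rw [Measure.restrict_apply hB]
    congr 1
    ext y
    simp only [Set.mem_inter_iff, Set.mem_ofPred_eq, Set.mem_preimage, he.exists, and_comm (a := y ∈ B),
      exists_and_right]
  · have hcl : ∀ S ⊆ points ξ, IsClosed S := fun S hS => hξ.isClosed_of_subset hS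
    have := Measure.nullSingletonClass_hausdorff (Space (m + 1)) one_pos
    -- The edge pieces cover the streets and exceed them at most by points of rank `m + 1`. Those
    -- are vertices, a countable set without one-dimensional Hausdorff measure.
    refine Measure.restrict_congr_set (EventuallyLE.antisymm ?_ ?_)
    · refine ae_le_set.2 (measure_mono_null ?_
        ((hξ.countable_crossroads (Nat.succ_pos m)).measure_zero _))
      rintro y ⟨hy, hys⟩
      have h₁ := (hξ.exists_mem_edgePiece_iff hm y).1 hy
      have h₂ := mt (mem_streets_of_finrank hcl) hys
      have h₃ : Module.finrank ℝ (vectorSpan ℝ (nearest (points ξ) y)) ≤ m + 1 := by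
        simpa using Submodule.finrank_le (vectorSpan ℝ (nearest (points ξ) y))
      rw [mem_crossroads_iff hcl]
      omega
    · refine (show streets (points ξ) ⊆ _ from fun y hy => ?_).eventuallyLE
      have := le_finrank_of_mem_streets hcl hy
      exact (hξ.exists_mem_edgePiece_iff hm y).2 (by omega)

end Edges

/-! ### Translation equivariance of the tessellation -/

section Equivariance

variable {d : ℕ}

theorem points_vadd (x : Space d) (ξ : Measure (Space d)) :
    points (x +ᵥ ξ) = (fun y => x + y) '' points ξ := by
  ext y
  simp only [points, Set.mem_ofPred_eq, vadd_measure_apply, Set.mem_image]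
  have : (fun z => x + z) ⁻¹' {y} = {y - x} := by
    ext z
    simp only [Set.mem_preimage, Set.mem_singleton_iff]
    exact ⟨fun h => by rw [← h]; abel, fun h => by rw [h]; abel⟩
  rw [this]
  constructor
  · exact fun h => ⟨y - x, h, by abel⟩
  · rintro ⟨z, hz, rfl⟩
    rwa [add_sub_cancel_left]

theorem nearest_image_add (x : Space d) (φ : Set (Space d)) (y : Space d) :
    nearest ((fun y => x + y) '' φ) (x + y) = (fun y => x + y) '' nearest φ y := by
  ext z
  simp only [nearest, cell, Set.mem_ofPred_eq, Set.mem_image]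
  constructor
  · rintro ⟨⟨w, hw, rfl⟩, h⟩
    exact ⟨w, ⟨hw, fun v hv => by simpa using h _ ⟨v, hv, rfl⟩⟩, rfl⟩
  · rintro ⟨w, ⟨hw, h⟩, rfl⟩
    refine ⟨⟨w, hw, rfl⟩, ?_⟩
    rintro _ ⟨v, hv, rfl⟩
    simpa using h v hv

theorem facetAt_image_add (x : Space d) (φ : Set (Space d)) (y : Space d) :
    facetAt ((fun y => x + y) '' φ) (x + y) = (fun y => x + y) '' facetAt φ y := by
  have hinj : Function.Injective fun y : Space d => x + y := add_right_injective x
  ext z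
  obtain ⟨w, rfl⟩ : ∃ w, x + w = z := ⟨z - x, by abel⟩
  rw [mem_facetAt, nearest_image_add, nearest_image_add, Set.image_subset_image_iff hinj,
    ← mem_facetAt, hinj.mem_set_image (s := facetAt φ y)]

theorem sUnion_facets_image_add (x : Space d) (φ : Set (Space d)) (k : ℕ) :
    ⋃₀ facets ((fun y => x + y) '' φ) k = (fun y => x + y) '' ⋃₀ facets φ k := by
  have hspan : ∀ F : Set (Space d), vectorSpan ℝ ((fun y => x + y) '' F) = vectorSpan ℝ F :=
    fun F => vectorSpan_vadd ℝ F x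
  ext z
  constructor
  · rintro ⟨_, ⟨⟨y, rfl⟩, hF⟩, hz⟩
    obtain ⟨w, rfl⟩ : ∃ w, x + w = y := ⟨y - x, by abel⟩
    rw [facetAt_image_add] at hz hF
    obtain ⟨v, hv, rfl⟩ := hz
    rw [hspan] at hF
    exact ⟨v, ⟨_, ⟨⟨w, rfl⟩, hF⟩, hv⟩, rfl⟩
  · rintro ⟨v, ⟨_, ⟨⟨w, rfl⟩, hF⟩, hv⟩, rfl⟩
    refine ⟨_, ⟨⟨x + w, rfl⟩, ?_⟩, ?_⟩
    · rw [facetAt_image_add, hspan, hF]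
    · rw [facetAt_image_add]
      exact ⟨v, hv, rfl⟩

theorem crossroads_vadd (x : Space d) (ξ : Measure (Space d)) :
    crossroads (points (x +ᵥ ξ)) = (fun y => x + y) '' crossroads (points ξ) := by
  rw [points_vadd]
  exact sUnion_facets_image_add x _ 0

theorem edgeLength_vadd (x : Space d) (ξ : Measure (Space d)) :
    edgeLength (x +ᵥ ξ) = x +ᵥ edgeLength ξ := by
  have hs : streets (points (x +ᵥ ξ)) = (fun y => x + y) '' streets (points ξ) := by
    rw [points_vadd]
    exact sUnion_facets_image_add x _ 1
  have hinj : Function.Injective fun y : Space d => x + y := add_right_injective x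
  have hH : (μH[1] : Measure (Space d)).map (fun y => x + y) = μH[1] :=
    (IsometryEquiv.addLeft x).map_hausdorffMeasure 1
  rw [edgeLength, hs, edgeLength]
  conv_lhs => rw [← hH]
  rw [show (Measure.map (fun y => x + y) (μH[1] : Measure (Space d))) = x +ᵥ μH[1] from rfl,
    vadd_measure_restrict, Set.preimage_image_eq _ hinj]

end Equivariance

/-- Two Markov kernels agree almost surely on each event if they do so on a class of events that
determines finite measures. -/
theorem ae_kernel_apply_eq {α β : Type*} [MeasurableSpace α] [MeasurableSpace β] {L : Measure α}
    [IsFiniteMeasure L] (k₁ k₂ : Kernel α β) [IsMarkovKernel k₁] [IsMarkovKernel k₂]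
    {C : Set (Set β)} (hdet : ∀ ν₁ ν₂ : Measure β, IsFiniteMeasure ν₁ →
      (∀ A ∈ C, ν₁ A = ν₂ A) → ν₁ = ν₂)
    (hC : ∀ A ∈ C, MeasurableSet A ∧ ∀ᵐ a ∂L, k₁ a A = k₂ a A) {A : Set β}
    (hA : MeasurableSet A) : ∀ᵐ a ∂L, k₁ a A = k₂ a A := by
  -- The null sets depend on the event and `C` may be uncountable, so no common null set is
  -- available. Integrating over an arbitrary `S` instead gives two finite measures that agree on
  -- `C`.
  refine ae_eq_of_forall_setLIntegral_eq_of_sigmaFinite (k₁.measurable_coe hA)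
    (k₂.measurable_coe hA) fun S hS _ => ?_
  have happ : ∀ (k : Kernel α β) (A : Set β), MeasurableSet A →
      (L.restrict S).bind k A = ∫⁻ a in S, k a A ∂L := fun k A hA =>
    Measure.bind_apply hA k.measurable.aemeasurable
  have heq : (L.restrict S).bind k₁ = (L.restrict S).bind k₂ := by
    refine hdet _ _ ⟨?_⟩ fun A hA => ?_
    · rw [happ _ _ MeasurableSet.univ]
      simp
    · rw [happ _ _ (hC A hA).1, happ _ _ (hC A hA).1]
      exact lintegral_congr_ae (ae_restrict_of_ae (hC A hA).2)
  rw [← happ _ _ hA, ← happ _ _ hA, heq]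

/-! ### The nuclei are mixing; equivariance of Cox kernels -/

section Nuclei

variable {d : ℕ}

/-- The translated law is again Poisson, with translated intensity; Lebesgue measure is invariant
and the intensity determines the law. -/
theorem IsPoissonLaw.map_vadd {L : Measure (Measure (Space d))} {c : ℝ≥0}
    (h : IsPoissonLaw L (c • (volume : Measure (Space d)))) (x : Space d) :
    L.map (fun ξ => x +ᵥ ξ) = L := by
  have := h.isProbabilityMeasure
  have := Measure.isProbabilityMeasure_map (μ := L) (measurable_vadd_measure x).aemeasurable
  have hvol : x +ᵥ (c • (volume : Measure (Space d))) = c • (volume : Measure (Space d)) := by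
    rw [vadd_measure_def, Measure.map_smul, map_add_left_eq_self]
  refine HasPoissonCylinders.unique (μ := c • (volume : Measure (Space d))) ?_
    h.hasPoissonCylinders
  have := h.hasPoissonCylinders.vadd x
  rwa [hvol] at this

theorem IsPoissonLaw.isMixing {L : Measure (Measure (Space d))} {c : ℝ≥0}
    (h : IsPoissonLaw L (c • (volume : Measure (Space d)))) : IsMixing L := by
  have := h.isProbabilityMeasure
  exact IsMixing.of_isSplice h.map_vadd fun K hK => h.hasPoissonCylinders.isSplice hK

/-- Conditional laws of Cox processes are equivariant. -/
theorem ae_poisson_kernel_equivariant {L : Measure (Measure (Space d))} [IsProbabilityMeasure L]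
    {x : Space d} (hL : MeasurePreserving (fun ξ : Measure (Space d) => x +ᵥ ξ) L L)
    (k : Kernel (Measure (Space d)) (Measure (Space d))) [IsMarkovKernel k]
    {μ : Measure (Space d) → Measure (Space d)}
    (hμx : ∀ᵐ ξ ∂L, μ (x +ᵥ ξ) = x +ᵥ μ ξ)
    (hk : ∀ (n : ℕ) (B : Fin n → Set (Space d)) (T : Fin n → Set ℝ≥0∞),
      (∀ i, MeasurableSet (B i)) → Pairwise (fun i j => Disjoint (B i) (B j)) →
      (∀ i, MeasurableSet (T i)) →
      ∀ᵐ ξ ∂L, k ξ (cylinderOf B T) = ∏ i, poissonDist (μ ξ (B i)) (T i))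
    {A : Set (Measure (Space d))} (hA : MeasurableSet A) :
    ∀ᵐ ξ ∂L, k (x +ᵥ ξ) A = k ξ ((fun η : Measure (Space d) => x +ᵥ η) ⁻¹' A) := by
  have hx := measurable_vadd_measure x
  have hmk : IsMarkovKernel (k.map fun η => x +ᵥ η) := Kernel.IsMarkovKernel.map k hx
  have key := ae_kernel_apply_eq (L := L) (k.comap _ hx) (k.map fun η => x +ᵥ η)
    (C := {S | ∃ (n : ℕ) (B : Fin n → Set (Space d)) (T : Fin n → Set ℝ≥0∞),
      ((∀ i, MeasurableSet (B i)) ∧ Pairwise (fun i j => Disjoint (B i) (B j)) ∧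
      ∀ i, MeasurableSet (T i)) ∧ S = cylinderOf B T}) ?_ ?_ hA
  · filter_upwards [key] with ξ hξ
    rwa [Kernel.comap_apply, Kernel.map_apply' _ hx _ hA] at hξ
  · intro ν₁ ν₂ _ h
    exact ext_of_cylinders MeasurableSet.univ fun n B T hB hd _ hT =>
      h _ ⟨n, B, T, ⟨hB, hd, hT⟩, rfl⟩
  · rintro _ ⟨n, B, T, ⟨hB, hd, hT⟩, rfl⟩
    have hcyl := measurableSet_cylinderOf hB hT
    refine ⟨hcyl, ?_⟩
    -- The cylinder formula is used twice: at the translated environment with the sets `B i`, and at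
    -- `ξ` with their preimages. Equivariance of `μ` matches the two products.
    filter_upwards [hL.quasiMeasurePreserving.ae (hk n B T hB hd hT), hμx,
      hk n (fun i => (fun y => x + y) ⁻¹' B i) T (fun i => measurable_const_add x (hB i))
        (fun i j hij => (hd hij).preimage _) hT] with ξ h₁ h₂ h₃
    rw [Kernel.comap_apply, Kernel.map_apply' _ hx _ hcyl, preimage_vadd_cylinderOf, h₃, h₁, h₂]
    simp only [vadd_measure_apply]

end Nuclei

/-! ### Users and relays on the Poisson-Voronoi tessellation -/

section Model

variable {m : ℕ} {Ω : Type*} [MeasurableSpace Ω] {P : Measure Ω} [IsProbabilityMeasure P]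
  {lamS lam : ℝ≥0} {p : unitInterval} {XS X Y : Ω → Measure (Space (m + 1))}

theorem IsUserRelayModel.isMixing (hm : 0 < m) (h : IsUserRelayModel P lamS lam p XS X Y) :
    IsMixing (P.map fun ω => X ω + Y ω) := by
  obtain ⟨κX, κY, hκX, hκY, hcond, hX, hY⟩ := h.users_relays
  obtain ⟨Λ, hΛ, hΛe⟩ := exists_measurable_edgeLength hm
  obtain ⟨b, hb, hbe⟩ := exists_measurable_bernoulliLaw_crossroads (Nat.succ_pos m) p
  set L := P.map XS with hLdef
  have hXS := h.aemeasurable_nuclei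
  have hLp : IsProbabilityMeasure L := h.nuclei.isProbabilityMeasure
  have hLmix : IsMixing L := h.nuclei.isMixing
  have hmp : ∀ x : Space (m + 1), MeasurePreserving (fun ξ => x +ᵥ ξ) L L := fun x =>
    ⟨measurable_vadd_measure x, h.nuclei.map_vadd x⟩
  have hpt : ∀ᵐ ξ ∂L, IsPointMeasure ξ := h.nuclei.isPointMeasure
  have hptΩ : ∀ᵐ ω ∂P, IsPointMeasure (XS ω) := ae_of_ae_map hXS hpt
  -- Passing from almost every `ω` to almost every `ξ` needs the exceptional set to be measurable,
  -- which is why `Λ` and `b` replace `edgeLength` and the Bernoulli law.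
  have transfer : ∀ {f g : Measure (Space (m + 1)) → ℝ≥0∞}, Measurable f → Measurable g →
      (∀ᵐ ω ∂P, f (XS ω) = g (XS ω)) → ∀ᵐ ξ ∂L, f ξ = g ξ := fun hf hg hfg =>
    (ae_map_iff hXS (measurableSet_eq_fun hf hg)).2 hfg
  have hplus : Measurable fun q : Measure (Space (m + 1)) × Measure (Space (m + 1)) =>
      q.1 + q.2 := measurable_fst.add measurable_snd
  have hmk : IsMarkovKernel ((κX ×ₖ κY).map fun q => q.1 + q.2) :=
    Kernel.IsMarkovKernel.map _ hplus
  -- Obtained by evaluating, at the edge length measure of the nuclei, the conditional law of the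
  -- superposition given that measure.
  let k : Kernel (Measure (Space (m + 1))) (Measure (Space (m + 1))) :=
    ((κX ×ₖ κY).map fun q => q.1 + q.2).comap Λ hΛ
  have hk : ∀ ξ A, MeasurableSet A →
      k ξ A = (κX ×ₖ κY) (Λ ξ) ((fun q => q.1 + q.2) ⁻¹' A) := fun ξ A hA => by
    rw [Kernel.comap_apply, Kernel.map_apply' _ hplus _ hA]
  have hlaw : P.map (fun ω => X ω + Y ω) = L.bind k := by
    have hc := hcond.comp_left hplus
    have hmap : P.map (fun ω => edgeLength (XS ω)) = L.map Λ := by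
      rw [AEMeasurable.map_map_of_aemeasurable hΛ.aemeasurable hXS]
      refine Measure.map_congr ?_
      filter_upwards [hptΩ] with ω hω
      exact (hΛe _ hω).symm
    have hsnd : P.map (fun ω => X ω + Y ω) =
        (P.map fun ω => edgeLength (XS ω)).bind ((κX ×ₖ κY).map fun q => q.1 + q.2) := by
      rw [← Measure.snd_compProd, ← hc.map_eq, Measure.snd_map_prodMk₀ hc.aemeasurable_fst]
      rfl
    rw [hsnd, hmap]
    ext A hA
    rw [Measure.bind_apply hA (Kernel.measurable _).aemeasurable,
      Measure.bind_apply hA (Kernel.measurable _).aemeasurable,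
      lintegral_map (Kernel.measurable_coe _ hA) hΛ]
    rfl
  have hXcyl : ∀ (n : ℕ) (B : Fin n → Set (Space (m + 1))) (T : Fin n → Set ℝ≥0∞),
      (∀ i, MeasurableSet (B i)) → Pairwise (fun i j => Disjoint (B i) (B j)) →
      (∀ i, MeasurableSet (T i)) →
      ∀ᵐ ξ ∂L, κX.comap Λ hΛ ξ (cylinderOf B T) =
        ∏ i, poissonDist ((lam • Λ ξ) (B i)) (T i) := by
    intro n B T hB hd hT
    refine transfer (Kernel.measurable_coe _ (measurableSet_cylinderOf hB hT)) ?_ ?_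
    · refine Finset.measurable_prod _ fun i _ => (measurable_poissonDist_apply (hT i)).comp ?_
      simp only [Measure.smul_apply]
      exact ((Measure.measurable_coe (hB i)).comp hΛ).const_smul lam
    · filter_upwards [hptΩ, hX] with ω hω hXω
      rw [Kernel.comap_apply, hΛe _ hω]
      exact hXω.hasPoissonCylinders n B T hB hd hT
  have hYb : ∀ A, MeasurableSet A → ∀ᵐ ξ ∂L, κY (Λ ξ) A = b ξ A := by
    intro A hA
    refine transfer ((κY.measurable_coe hA).comp hΛ) ((Measure.measurable_coe hA).comp hb) ?_
    filter_upwards [hptΩ, hY] with ω hω hYω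
    rw [hΛe _ hω, hYω, hbe _ hω]
  have hequivX : ∀ (x : Space (m + 1)) (A : Set (Measure (Space (m + 1)))), MeasurableSet A →
      ∀ᵐ ξ ∂L, κX (Λ (x +ᵥ ξ)) A =
        κX (Λ ξ) ((fun η : Measure (Space (m + 1)) => x +ᵥ η) ⁻¹' A) := by
    intro x A hA
    refine ae_poisson_kernel_equivariant (hmp x) (κX.comap Λ hΛ) ?_ hXcyl hA
    filter_upwards [hpt, (hmp x).quasiMeasurePreserving.ae hpt] with ξ h₁ h₂
    rw [hΛe _ h₁, hΛe _ h₂, edgeLength_vadd, vadd_measure_def, vadd_measure_def, Measure.map_smul]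
  have hequivY : ∀ (x : Space (m + 1)) (A : Set (Measure (Space (m + 1)))), MeasurableSet A →
      ∀ᵐ ξ ∂L, κY (Λ (x +ᵥ ξ)) A =
        κY (Λ ξ) ((fun η : Measure (Space (m + 1)) => x +ᵥ η) ⁻¹' A) := by
    intro x A hA
    have hx := measurable_vadd_measure x
    filter_upwards [hpt, (hmp x).quasiMeasurePreserving.ae hpt, hYb _ (hx hA),
      (hmp x).quasiMeasurePreserving.ae (hYb A hA)] with ξ h₁ h₂ h₃ h₄
    rw [h₃, h₄, hbe _ h₁, hbe _ h₂, crossroads_vadd,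
      ← bernoulliLaw_vadd (h₁.countable_crossroads (Nat.succ_pos m)), Measure.map_apply hx hA]
  rw [hlaw]
  refine hLmix.comp_kernel k (fun x A hA => ?_) (fun K A B hK hA hB hAK hBK => ?_)
  · have hx := measurable_vadd_measure x
    have hxx := hx.prodMap hx
    have hmk₂ : IsMarkovKernel (((κX ×ₖ κY).comap Λ hΛ).map
        (Prod.map (fun η => x +ᵥ η) fun η => x +ᵥ η)) := Kernel.IsMarkovKernel.map _ hxx
    -- Equivariance of the joint conditional law of users and relays is checked on rectangles, where
    -- it reduces to that of `κX` and of `κY`.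
    have key := ae_kernel_apply_eq (L := L) ((κX ×ₖ κY).comap _ (hΛ.comp hx))
      (((κX ×ₖ κY).comap Λ hΛ).map (Prod.map (fun η => x +ᵥ η) fun η => x +ᵥ η))
      (C := {S | ∃ A₁ A₂, MeasurableSet A₁ ∧ MeasurableSet A₂ ∧ S = A₁ ×ˢ A₂}) ?_ ?_ (hplus hA)
    · filter_upwards [key] with ξ hξ
      rw [hk _ _ hA, hk _ _ (hx hA)]
      rw [Kernel.comap_apply, Kernel.map_apply' _ hxx _ (hplus hA), Kernel.comap_apply] at hξ
      refine hξ.trans ?_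
      congr 1
      ext q
      simp only [Set.mem_preimage, Prod.map_fst, Prod.map_snd, vadd_measure_add]
    · intro ν₁ ν₂ _ hν
      exact Measure.ext_prod fun hs ht => hν _ ⟨_, _, hs, ht, rfl⟩
    · rintro _ ⟨A₁, A₂, h₁, h₂, rfl⟩
      refine ⟨h₁.prod h₂, ?_⟩
      filter_upwards [hequivX x A₁ h₁, hequivY x A₂ h₂] with ξ e₁ e₂
      rw [Kernel.comap_apply, Kernel.map_apply' _ hxx _ (h₁.prod h₂), Kernel.comap_apply,
        show Prod.map (fun η : Measure (Space (m + 1)) => x +ᵥ η) (fun η => x +ᵥ η) ⁻¹' (A₁ ×ˢ A₂) =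
          ((fun η => x +ᵥ η) ⁻¹' A₁) ×ˢ ((fun η => x +ᵥ η) ⁻¹' A₂) from rfl, Kernel.prod_apply, Kernel.prod_apply, Measure.prod_prod,
        Measure.prod_prod, ← e₁, ← e₂]
      rfl
  -- Only the numerical identity for fixed `A` and `B` is transferred; `IsSplice` itself is
  -- established at `XS ω`, where the hypotheses on the conditional laws are available.
  · refine transfer (k.measurable_coe (hA.inter hB))
      ((k.measurable_coe hA).mul (k.measurable_coe hB)) ?_
    filter_upwards [hptΩ, hX, hY] with ω hω hXω hYω
    have hsX : IsSplice K (κX (Λ (XS ω))) := by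
      rw [hΛe _ hω]
      exact hXω.hasPoissonCylinders.isSplice hK
    have hsY : IsSplice K (κY (Λ (XS ω))) := by
      rw [hΛe _ hω, hYω]
      exact isSplice_bernoulliLaw (hω.countable_crossroads (Nat.succ_pos m)) p hK
    have hs : IsSplice K (k (XS ω)) := by
      have : k (XS ω) =
          ((κX (Λ (XS ω))).prod (κY (Λ (XS ω)))).map fun q => q.1 + q.2 := by
        rw [Kernel.comap_apply, Kernel.map_apply _ hplus, Kernel.prod_apply]
      rw [this]
      exact hsX.add hK hsY
    exact hs.measure_inter hK hA hB hAK hBK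

end Model

end CoxVoronoi

theorem mainTheorem5 {d : ℕ} (hd : 2 ≤ d) {Ω : Type*} [MeasurableSpace Ω] (P : Measure Ω)
    [IsProbabilityMeasure P] (lamS lam : ℝ≥0) (hlamS : 0 < lamS) (p : unitInterval)
    (XS X Y : Ω → Measure (CoxVoronoi.Space d))
    (h : CoxVoronoi.IsUserRelayModel P lamS lam p XS X Y) :
    CoxVoronoi.IsMixing (P.map (fun ω => X ω + Y ω)) ∧
      ErgodicVAdd (CoxVoronoi.Space d) (Measure (CoxVoronoi.Space d))
        (P.map (fun ω => X ω + Y ω)) := by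
  -- Edges are cut out by `m = d - 1` bisectors, and `2 ≤ d` makes this number positive.
  obtain ⟨m, rfl⟩ : ∃ m, d = m + 1 := ⟨d - 1, by omega⟩
  have hmix := h.isMixing (by omega)
  obtain ⟨κX, κY, -, -, hcond, -, -⟩ := h.users_relays
  have hXY := hcond.aemeasurable_snd
  have : IsProbabilityMeasure (P.map fun ω => X ω + Y ω) :=
    Measure.isProbabilityMeasure_map (hXY.fst.add hXY.snd)
  exact ⟨hmix, hmix.ergodicVAdd (Nat.succ_pos m)⟩
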